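/- Let $\mathcal D$ be a triangulated category. By a heart in $\mathcal D$ we mean the heart of a bounded t-structure on $\mathcal D$; hearts are ordered by inclusion of the co-aisles of their t-structures, so that $\mathcal H[1]\ge\mathcal H$. Let $\mathcal H$ be a heart in $\mathcal D$ that is algebraic, i.e. as an abelian category it is noetherian and artinian and has only finitely many simple objects up to isomorphism. Let $\Lambda=K(\mathcal H)=K(\mathcal D)$ be the Grothendieck group. For a heart $\mathcal K$ in $\mathcal D$ let $$C(\mathcal K)=\{v\in\mathrm{Hom}(\Lambda,\mathbb R)\mid v([k])\ge 0\text{ for all }k\in\mathcal K\}$$ be its heart cone. A face of a convex cone $\sigma$ is a non-empty subset $\tau\subseteq\sigma$ such that for all $a,b\in\sigma$ one has $a+b\in\tau$ if and only if $a,b\in\tau$. The heart fan $\Delta(\mathcal H)$ is the set consisting of the heart cones $C(\mathcal K)$ of all hearts $\mathcal K$ in $\mathcal D$ with $\mathcal H[1]\ge\mathcal K\ge\mathcal H$ and all faces of these cones. Then the following are equivalent: (i) the heart fan $\Delta(\mathcal H)$ is a finite set; (ii) every heart $\mathcal K$ in $\mathcal D$ with $\mathcal H[1]\ge\mathcal K\ge\mathcal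 H$ is algebraic; (iii) there are only finitely many hearts $\mathcal K$ in $\mathcal D$ with $\mathcal H[1]\ge\mathcal K\ge\mathcal H$. -/

import Mathlib

open CategoryTheory CategoryTheory.Limits CategoryTheory.Pretriangulated CategoryTheory.Triangulated

universe v u

/-- An abelian category is algebraic if it is noetherian and artinian (all ascending and all
descending chains of subobjects stabilise) and has only finitely many isomorphism classes of
simple objects. -/
structure IsAlgebraicCategory (A : Type u) [Category.{v} A] [HasZeroMorphisms A] : Prop where
  noetherian : ∀ X : A, IsNoetherianObject X
  artinian : ∀ X : A, IsArtinianObject X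
  finite_simples :
    {c : Quotient (isIsomorphicSetoid A) | ∃ S : A, Simple S ∧ Quotient.mk _ S = c}.Finite

section

variable (D : Type u) [Category.{v} D] [Preadditive D] [HasZeroObject D] [HasShift D ℤ]
  [∀ n : ℤ, (shiftFunctor D n).Additive] [Pretriangulated D]

/-- The subgroup of the free abelian group on the objects of `D` that is generated by the
elements `Y - (X + Z)` for the distinguished triangles `X ⟶ Y ⟶ Z ⟶ X⟦1⟧`. -/
def triangleRelations : AddSubgroup (FreeAbelianGroup D) :=
  AddSubgroup.closure {r | ∃ T ∈ distTriang D, r =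
    FreeAbelianGroup.of T.obj₂ - (FreeAbelianGroup.of T.obj₁ + FreeAbelianGroup.of T.obj₃)}

/-- The Grothendieck group `K(D)` of a triangulated category `D`. For the heart `H` of a bounded
t-structure on `D`, the inclusion induces the canonical identification `K(H) = K(D)`. -/
abbrev TriangulatedK : Type u := FreeAbelianGroup D ⧸ triangleRelations D

variable {D}

/-- The class `[X]` in `K(D)` of an object `X` of `D`. -/
def TriangulatedK.cls (X : D) : TriangulatedK D :=
  QuotientAddGroup.mk (FreeAbelianGroup.of X)

variable (D) in
/-- A bounded t-structure on `D`, standing for its heart: every object of `D` lies in some shift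
of the aisle `le 0` and in some shift of the co-aisle `ge 1`. -/
structure BoundedHeart where
  /-- the t-structure -/
  tStructure : TStructure D
  bounded : ∀ X : D, tStructure.bounded X

namespace BoundedHeart

/-- The heart, as a strictly full subcategory of `D`. -/
def obj (H : BoundedHeart D) : ObjectProperty D := H.tStructure.heart

/-- The heart as a category. -/
abbrev Cat (H : BoundedHeart D) : Type u := H.obj.FullSubcategory

/-- The heart is an algebraic (abelian) category. -/
def IsAlgebraic (H : BoundedHeart D) : Prop := IsAlgebraicCategory H.Cat

/-- The order on bounded hearts: `H ≤ K` if the co-aisle of `H` is contained in that of `K`. -/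
instance : Preorder (BoundedHeart D) where
  le H K := H.tStructure.ge 1 ≤ K.tStructure.ge 1
  le_refl H := le_refl (H.tStructure.ge 1)
  le_trans _ _ _ h₁ h₂ := le_trans h₁ h₂

/-- The shifted heart `H[1]`. -/
def shift (H : BoundedHeart D) : BoundedHeart D where
  tStructure :=
    { le := fun n => H.tStructure.le (n - 1)
      ge := fun n => H.tStructure.ge (n - 1)
      le_shift := fun n a n' h X hX => H.tStructure.le_shift (n - 1) a (n' - 1) (by lia) X hX
      ge_shift := fun n a n' h X hX => H.tStructure.ge_shift (n - 1) a (n' - 1) (by lia) X hX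
      zero' := fun X Y f hX hY =>
        H.tStructure.zero_of_isLE_of_isGE f (0 - 1) (1 - 1) (by lia) ⟨hX⟩ ⟨hY⟩
      le_zero_le := H.tStructure.le_monotone (by lia)
      ge_one_le := H.tStructure.ge_antitone (by lia)
      exists_triangle_zero_one := fun A =>
        H.tStructure.exists_triangle A (0 - 1) (1 - 1) (by lia) }
  bounded := fun X => by
    obtain ⟨⟨m, hm⟩, ⟨n, hn⟩⟩ := H.bounded X
    refine ⟨⟨m + 1, ⟨?_⟩⟩, ⟨n + 1, ⟨?_⟩⟩⟩
    · simpa using hm.ge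
    · simpa using hn.le

/-- The objects of `H[1]` are those of the form `Y⟦1⟧` with `Y` in `H`, up to isomorphism. -/
theorem shift_obj_iff (H : BoundedHeart D) (X : D) :
    H.shift.obj X ↔ H.obj (X⟦(-1 : ℤ)⟧) := by
  have hl : H.tStructure.le (0 - 1) X ↔ H.tStructure.le 0 (X⟦(-1 : ℤ)⟧) := by
    rw [TStructure.le_iff_isLE, TStructure.le_iff_isLE]
    exact (H.tStructure.isLE_shift_iff X (0 - 1) (-1) 0 (by lia)).symm
  have hg : H.tStructure.ge (0 - 1) X ↔ H.tStructure.ge 0 (X⟦(-1 : ℤ)⟧) := by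
    rw [TStructure.ge_iff_isGE, TStructure.ge_iff_isGE]
    exact (H.tStructure.isGE_shift_iff X (0 - 1) (-1) 0 (by lia)).symm
  exact and_congr hl hg

/-- The heart cone `C(H) = {v | v([h]) ≥ 0 for all h in H}`, a cone in the real vector space
`Hom(K(D), ℝ)`. -/
def heartCone (H : BoundedHeart D) : PointedCone ℝ (TriangulatedK D →+ ℝ) where
  carrier := {v | ∀ X : D, H.obj X → 0 ≤ v (TriangulatedK.cls X)}
  zero_mem' := fun _ _ => le_refl (0 : ℝ)
  add_mem' := fun ha hb X hX => add_nonneg (ha X hX) (hb X hX)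
  smul_mem' := fun c _ ha X hX => mul_nonneg c.2 (ha X hX)

/-- The heart fan of `H`: the heart cones `C(K)` of all hearts `H ≤ K ≤ H[1]`, together with
all their faces. -/
def heartFan (H : BoundedHeart D) : Set (PointedCone ℝ (TriangulatedK D →+ ℝ)) :=
  {τ | ∃ K ∈ Set.Icc H H.shift, τ.IsFaceOf K.heartCone}

end BoundedHeart

end

/-!
The intermediate hearts `H ≤ K ≤ H[1]` are the tilts of `H` at its torsion pairs, and `K` is
determined by its torsion-free class `H.free K`, the objects of `H` whose shifts lie in `K`. All
statements about the abelian category `H` are phrased through distinguished triangles with terms in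
`H`, written `IsExt A X B`.

**Functionals.** A heart that is a length category has a functional `K(D) → ℤ` for every class of
simple objects, which counts the composition factors in this class
(`exists_multiplicity_functional`); it extends from the heart to `K(D)` as an Euler characteristic
(`IsAdditive.exists_extension`). So the algebraic hearts are exactly the hearts with a functional
that is positive on nonzero objects, provided that `K(D)` is finitely generated
(`IsPositive.isAlgebraic`), which holds as `H` is algebraic. Such a functional also bounds all
procedures in the heart, so that every torsion-free class can be tilted at (`tilt`).

**Finitely many cones imply that all hearts are algebraic.** Let `L` be an intermediate algebraic
heart, `L < K`, and choose a simple object `S` of `L` that is torsion-free for `K`. Let `s` count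
the composition factors `S` in `L`, and let `w` count the others. Each of the integral functionals
`N • w - s` lies in some heart cone, that of the tilt of `H` at the objects all of whose nonzero
subobjects are negative. If there are finitely many cones, one of them, say that of `J`, contains
infinitely many of these functionals. They approach the wall `S = 0` of the cone of `L` from
outside, which forces `L < J ≤ K`, and the sum of two of them is positive on `J`, so that `J` is
algebraic again (`isPositive_of_wall_crossing`). Walking from `H` towards `K` this way produces
distinct cones, since a functional that is positive on a heart is in the cone of no larger one
(`heartCone_ne`). Hence the walk ends, and it can only end at `K`.

**If all hearts are algebraic, there are finitely many.** If there are infinitely many hearts above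
`L`, then one of the finitely many simple objects of `L` is torsion-free for infinitely many of
them, and these lie above a heart that is strictly larger than `L` (`exists_gt_infinite`). So there
would be a strictly increasing sequence of intermediate hearts. Its supremum has finitely many
simple objects, all of which lie in a common member of the sequence, which is then equal to the
supremum (`exists_not_isAlgebraic_of_strictMono`).

**Finitely many faces.** The cone of an algebraic heart is cut out by its finitely many simple
objects, and a face is determined by the simple objects at which it vanishes
(`IsAlgebraic.finite_faces`).
-/

/-! ### Extensions in a triangulated category -/

section Extensions

variable {D : Type u} [Category.{v} D] [Preadditive D] [HasZeroObject D] [HasShift D ℤ]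
  [∀ n : ℤ, (shiftFunctor D n).Additive] [Pretriangulated D]

/-- `IsExt A X B` says that there is a distinguished triangle `A ⟶ X ⟶ B ⟶ A⟦1⟧`, so that `X` is
an extension of `B` by `A`. When the three objects lie in the heart of a t-structure, this is the
existence of a short exact sequence `0 ⟶ A ⟶ X ⟶ B ⟶ 0` in the heart. -/
def IsExt (A X B : D) : Prop :=
  ∃ (f : A ⟶ X) (g : X ⟶ B) (h : B ⟶ A⟦(1 : ℤ)⟧), Triangle.mk f g h ∈ distTriang D

namespace IsExt

theorem of_triangle {T : Triangle D} (hT : T ∈ distTriang D) : IsExt T.obj₁ T.obj₂ T.obj₃ :=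
  ⟨_, _, _, hT⟩

theorem of_iso {A X B A' X' B' : D} (h : IsExt A X B) (e₁ : A ≅ A') (e₂ : X ≅ X')
    (e₃ : B ≅ B') : IsExt A' X' B' := by
  obtain ⟨f, g, k, hT⟩ := h
  refine ⟨e₁.inv ≫ f ≫ e₂.hom, e₂.inv ≫ g ≫ e₃.hom, e₃.inv ≫ k ≫ e₁.hom⟦(1 : ℤ)⟧', ?_⟩
  refine isomorphic_distinguished _ hT _ (Triangle.isoMk _ _ e₁.symm e₂.symm e₃.symm ?_ ?_ ?_)
  · change (e₁.inv ≫ f ≫ e₂.hom) ≫ e₂.inv = e₁.inv ≫ f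
    simp
  · change (e₂.inv ≫ g ≫ e₃.hom) ≫ e₃.inv = e₂.inv ≫ g
    simp
  · change (e₃.inv ≫ k ≫ e₁.hom⟦(1 : ℤ)⟧') ≫ e₁.inv⟦(1 : ℤ)⟧' = e₃.inv ≫ k
    simp [← Functor.map_comp]

theorem rot {A X B : D} (h : IsExt A X B) : IsExt X B (A⟦(1 : ℤ)⟧) := by
  obtain ⟨f, g, k, hT⟩ := h
  exact of_triangle (rot_of_distTriang _ hT)

theorem inv_rot {A X B : D} (h : IsExt A X B) : IsExt (B⟦(-1 : ℤ)⟧) A X := by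
  obtain ⟨f, g, k, hT⟩ := h
  exact of_triangle (inv_rot_of_distTriang _ hT)

theorem shift {A X B : D} (h : IsExt A X B) (n : ℤ) : IsExt (A⟦n⟧) (X⟦n⟧) (B⟦n⟧) := by
  obtain ⟨f, g, k, hT⟩ := h
  exact of_triangle (Triangle.shift_distinguished _ hT n)

theorem of_shift {A X B : D} (n : ℤ) (h : IsExt (A⟦n⟧) (X⟦n⟧) (B⟦n⟧)) : IsExt A X B :=
  (h.shift (-n)).of_iso ((shiftEquiv D n).unitIso.symm.app A)
    ((shiftEquiv D n).unitIso.symm.app X) ((shiftEquiv D n).unitIso.symm.app B)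

/-- The inverse of `IsExt.inv_rot`. -/
theorem of_inv_rot {A X B : D} (h : IsExt (B⟦(-1 : ℤ)⟧) A X) : IsExt A X B :=
  h.rot.of_iso (Iso.refl _) (Iso.refl _) ((shiftEquiv D (1 : ℤ)).counitIso.app B)

/-- The inverse of `IsExt.rot`. -/
theorem of_rot {A X B : D} (h : IsExt X B (A⟦(1 : ℤ)⟧)) : IsExt A X B :=
  h.inv_rot.of_iso ((shiftEquiv D (1 : ℤ)).unitIso.symm.app A) (Iso.refl _) (Iso.refl _)

theorem zero_right (X : D) {Z : D} (hZ : IsZero Z) : IsExt X X Z :=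
  (of_triangle (contractible_distinguished X)).of_iso (Iso.refl _) (Iso.refl _)
    ((isZero_zero D).iso hZ)

theorem zero_left (X : D) {Z : D} (hZ : IsZero Z) : IsExt Z X X :=
  (of_triangle (contractible_distinguished₁ X)).of_iso ((isZero_zero D).iso hZ) (Iso.refl _)
    (Iso.refl _)

theorem iso_of_isZero_right {A X B : D} (h : IsExt A X B) (hB : IsZero B) : Nonempty (A ≅ X) := by
  obtain ⟨f, g, k, hT⟩ := h
  have : IsIso f := (Triangle.isZero₃_iff_isIso₁ _ hT).1 hB
  exact ⟨asIso f⟩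

theorem iso_of_isZero_left {A X B : D} (h : IsExt A X B) (hA : IsZero A) : Nonempty (X ≅ B) := by
  obtain ⟨f, g, k, hT⟩ := h
  have : IsIso g := (Triangle.isZero₁_iff_isIso₂ _ hT).1 hA
  exact ⟨asIso g⟩

theorem isZero_mid {A X B : D} (h : IsExt A X B) (hA : IsZero A) (hB : IsZero B) : IsZero X := by
  obtain ⟨e⟩ := h.iso_of_isZero_left hA
  exact hB.of_iso e

theorem hom_to_mid_eq_zero {A X B Y : D} (h : IsExt A X B) (hA : ∀ f : Y ⟶ A, f = 0)
    (hB : ∀ f : Y ⟶ B, f = 0) (f : Y ⟶ X) : f = 0 := by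
  obtain ⟨a, b, k, hT⟩ := h
  obtain ⟨l, hl⟩ : ∃ l : Y ⟶ A, f = l ≫ a := Triangle.coyoneda_exact₂ _ hT f (hB _)
  rw [hl, hA l, zero_comp]

theorem hom_from_mid_eq_zero {A X B Y : D} (h : IsExt A X B) (hA : ∀ f : A ⟶ Y, f = 0)
    (hB : ∀ f : B ⟶ Y, f = 0) (f : X ⟶ Y) : f = 0 := by
  obtain ⟨a, b, k, hT⟩ := h
  obtain ⟨l, hl⟩ : ∃ l : B ⟶ Y, f = b ≫ l := Triangle.yoneda_exact₂ _ hT f (hA _)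
  rw [hl, hB l, comp_zero]

theorem hom_eq_zero_of_comp {A X B Y : D} {a : A ⟶ X} {b : X ⟶ B} {c : B ⟶ A⟦(1 : ℤ)⟧}
    (hT : Triangle.mk a b c ∈ distTriang D) (hB : ∀ f : Y ⟶ B⟦(-1 : ℤ)⟧, f = 0) {u : Y ⟶ A}
    (hu : u ≫ a = 0) : u = 0 := by
  obtain ⟨l, hl⟩ := Triangle.coyoneda_exact₂ _ (inv_rot_of_distTriang _ hT) u hu
  refine hl.trans ?_
  obtain rfl : l = 0 := hB l
  exact zero_comp

/-- The octahedral axiom: if `A` is the fibre of `X ⟶ B` and `B₁` that of `B ⟶ B₂`, then the fibre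
of the composite is an extension of `B₁` by `A`. -/
theorem of_fibre_comp [IsTriangulated D] {A X B B₁ B₂ V : D} {a : A ⟶ X} {b : X ⟶ B}
    {c : B ⟶ A⟦(1 : ℤ)⟧} {p : B₁ ⟶ B} {q : B ⟶ B₂} {r : B₂ ⟶ B₁⟦(1 : ℤ)⟧} {j : V ⟶ X}
    {m : B₂ ⟶ V⟦(1 : ℤ)⟧} (hT : Triangle.mk a b c ∈ distTriang D)
    (hT' : Triangle.mk p q r ∈ distTriang D) (hV : Triangle.mk j (b ≫ q) m ∈ distTriang D) :
    IsExt A V B₁ := by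
  have O := someOctahedron (rfl : b ≫ q = b ≫ q) (rot_of_distTriang _ hT)
    (rot_of_distTriang _ hT') (rot_of_distTriang _ hV)
  have h1 : IsExt (A⟦(1 : ℤ)⟧) (V⟦(1 : ℤ)⟧) (B₁⟦(1 : ℤ)⟧) := ⟨_, _, _, O.mem⟩
  exact h1.of_shift 1

/-- A morphism `a : A ⟶ X` whose cone is an extension of `B₂` by `B₁` factors through an extension
`Y` of `B₁` by `A`. -/
theorem exists_factorization [IsTriangulated D] {A X B B₁ B₂ : D} {a : A ⟶ X} {b : X ⟶ B}
    {c : B ⟶ A⟦(1 : ℤ)⟧} (hT : Triangle.mk a b c ∈ distTriang D) (h' : IsExt B₁ B B₂) :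
    ∃ Y, IsExt A Y B₁ ∧ IsExt Y X B₂ ∧ (IsZero Y → a = 0) := by
  obtain ⟨p, q, r, hT'⟩ := h'
  obtain ⟨Y, j, m, hY⟩ := distinguished_cocone_triangle₁ (b ≫ q)
  refine ⟨Y, of_fibre_comp hT hT' hY, ⟨_, _, _, hY⟩, fun h0 => ?_⟩
  have hab : a ≫ b = 0 := comp_distTriang_mor_zero₁₂ _ hT
  obtain ⟨l, hl⟩ : ∃ l : A ⟶ Y, a = l ≫ j :=
    Triangle.coyoneda_exact₂ _ hY a (by change a ≫ b ≫ q = 0; rw [← Category.assoc, hab, zero_comp])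
  rw [hl, h0.eq_of_tgt l 0, zero_comp]

/-- Extensions are associative: an extension by `A` of an extension of `B₂` by `B₁` is an
extension of `B₂` by an extension of `B₁` by `A`. -/
theorem assoc [IsTriangulated D] {A X B B₁ B₂ : D} (h : IsExt A X B) (h' : IsExt B₁ B B₂) :
    ∃ Y, IsExt A Y B₁ ∧ IsExt Y X B₂ := by
  obtain ⟨a, b, c, hT⟩ := h
  obtain ⟨Y, h₁, h₂, -⟩ := exists_factorization hT h'
  exact ⟨Y, h₁, h₂⟩

theorem assoc' [IsTriangulated D] {A X B A₁ A₂ : D} (h : IsExt A X B) (h' : IsExt A₁ A A₂) :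
    ∃ Y, IsExt A₁ X Y ∧ IsExt A₂ Y B := by
  obtain ⟨a, b, c, hT⟩ := h
  obtain ⟨p, q, r, hT'⟩ := h'
  obtain ⟨Z, u, w, hZ⟩ := distinguished_cocone_triangle (p ≫ a)
  have O := someOctahedron (rfl : p ≫ a = p ≫ a) hT' hT hZ
  exact ⟨Z, ⟨_, _, _, hZ⟩, ⟨_, _, _, O.mem⟩⟩

/-- If `X` is an extension in two ways, then the composites `A ⟶ X ⟶ B'` and `A' ⟶ X ⟶ B` have a
common cone. -/
theorem exists_common_cone [IsTriangulated D] {A X B A' B' : D} (h : IsExt A X B)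
    (h' : IsExt A' X B') : ∃ C, IsExt A B' C ∧ IsExt A' B C := by
  obtain ⟨a, b, c, hT⟩ := h
  obtain ⟨p, q, r, hT'⟩ := h'
  obtain ⟨Z, u, w, hZ⟩ := distinguished_cocone_triangle (a ≫ q)
  have O := someOctahedron (rfl : a ≫ q = a ≫ q) hT (rot_of_distTriang _ hT') hZ
  have h1 : IsExt B Z (A'⟦(1 : ℤ)⟧) := ⟨_, _, _, O.mem⟩
  exact ⟨Z, ⟨_, _, _, hZ⟩, h1.of_rot⟩

end IsExt

namespace TriangulatedK

theorem cls_ext {A X B : D} (h : IsExt A X B) : cls X = cls A + cls B := by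
  obtain ⟨f, g, k, hT⟩ := h
  have : (QuotientAddGroup.mk (FreeAbelianGroup.of X -
      (FreeAbelianGroup.of A + FreeAbelianGroup.of B)) : TriangulatedK D) = 0 := by
    rw [QuotientAddGroup.eq_zero_iff]
    exact AddSubgroup.subset_closure ⟨_, hT, rfl⟩
  rw [QuotientAddGroup.mk_sub, QuotientAddGroup.mk_add, sub_eq_zero] at this
  exact this

theorem cls_isZero {X : D} (hX : IsZero X) : cls X = 0 := by
  have := cls_ext (IsExt.zero_left X hX)
  simpa using this

theorem cls_iso {X Y : D} (e : X ≅ Y) : cls X = cls Y := by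
  have := cls_ext ((IsExt.zero_left X (isZero_zero D)).of_iso (Iso.refl _) e (Iso.refl _))
  rw [cls_isZero (isZero_zero D), zero_add] at this
  exact this.symm

theorem cls_shift_one (X : D) : cls (X⟦(1 : ℤ)⟧) = - cls X := by
  have := cls_ext (IsExt.zero_right X (isZero_zero D)).rot
  rw [cls_isZero (isZero_zero D)] at this
  exact eq_neg_of_add_eq_zero_right this.symm

/-- A function on objects that is additive on distinguished triangles factors over `K(D)`. -/
def lift (χ : D → ℤ) (hχ : ∀ {A X B : D}, IsExt A X B → χ X = χ A + χ B) :
    TriangulatedK D →+ ℤ :=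
  QuotientAddGroup.lift _ (FreeAbelianGroup.lift χ) (by
    rw [triangleRelations, AddSubgroup.closure_le]
    rintro _ ⟨T, hT, rfl⟩
    simp [hχ (IsExt.of_triangle hT)])

@[simp]
theorem lift_cls (χ : D → ℤ) (hχ : ∀ {A X B : D}, IsExt A X B → χ X = χ A + χ B) (X : D) :
    lift χ hχ (cls X) = χ X := by
  simp [lift, cls]

end TriangulatedK

end Extensions

/-! ### Aisles, co-aisles and the heart of a bounded t-structure -/

section HeartBasics

variable {D : Type u} [Category.{v} D] [Preadditive D] [HasZeroObject D] [HasShift D ℤ]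
  [∀ n : ℤ, (shiftFunctor D n).Additive] [Pretriangulated D]

namespace BoundedHeart

variable (H : BoundedHeart D)

/-- The objects that are `≤ n` for the t-structure with heart `H`. -/
abbrev aisle (n : ℤ) : ObjectProperty D := H.tStructure.le n

/-- The objects that are `≥ n` for the t-structure with heart `H`. -/
abbrev coaisle (n : ℤ) : ObjectProperty D := H.tStructure.ge n

variable {H}

theorem aisle_of_iso {n : ℤ} {X Y : D} (e : X ≅ Y) (h : H.aisle n X) : H.aisle n Y :=
  (H.aisle n).prop_of_iso e h

theorem coaisle_of_iso {n : ℤ} {X Y : D} (e : X ≅ Y) (h : H.coaisle n X) : H.coaisle n Y :=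
  (H.coaisle n).prop_of_iso e h

theorem obj_of_iso {X Y : D} (e : X ≅ Y) (h : H.obj X) : H.obj Y :=
  ⟨aisle_of_iso e h.1, coaisle_of_iso e h.2⟩

theorem aisle_mono {m n : ℤ} (hmn : m ≤ n) {X : D} (h : H.aisle m X) : H.aisle n X :=
  H.tStructure.le_monotone hmn X h

theorem coaisle_anti {m n : ℤ} (hmn : m ≤ n) {X : D} (h : H.coaisle n X) : H.coaisle m X :=
  H.tStructure.ge_antitone hmn X h

theorem aisle_shift_iff {X : D} (n a n' : ℤ) (h : a + n' = n) :
    H.aisle n' (X⟦a⟧) ↔ H.aisle n X := by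
  simpa only [aisle, TStructure.le_iff_isLE] using H.tStructure.isLE_shift_iff X n a n' h

theorem coaisle_shift_iff {X : D} (n a n' : ℤ) (h : a + n' = n) :
    H.coaisle n' (X⟦a⟧) ↔ H.coaisle n X := by
  simpa only [coaisle, TStructure.ge_iff_isGE] using H.tStructure.isGE_shift_iff X n a n' h

theorem hom_eq_zero {m n : ℤ} (hmn : m < n) {X Y : D} (hX : H.aisle m X) (hY : H.coaisle n Y)
    (f : X ⟶ Y) : f = 0 :=
  H.tStructure.zero_of_isLE_of_isGE f m n hmn ⟨hX⟩ ⟨hY⟩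

theorem isZero_of_aisle_of_coaisle {m n : ℤ} (hmn : m < n) {X : D} (hX : H.aisle m X)
    (hY : H.coaisle n X) : IsZero X := by
  rw [IsZero.iff_id_eq_zero]
  exact hom_eq_zero hmn hX hY _

theorem aisle_of_isZero {X : D} (hX : IsZero X) (n : ℤ) : H.aisle n X :=
  (H.tStructure.isLE_of_isZero hX n).le

theorem coaisle_of_isZero {X : D} (hX : IsZero X) (n : ℤ) : H.coaisle n X :=
  (H.tStructure.isGE_of_isZero hX n).ge

theorem obj_of_isZero {X : D} (hX : IsZero X) : H.obj X :=
  ⟨aisle_of_isZero hX 0, coaisle_of_isZero hX 0⟩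

theorem aisle_of_hom_eq_zero {n : ℤ} {X : D}
    (h : ∀ Y : D, H.coaisle (n + 1) Y → ∀ f : X ⟶ Y, f = 0) : H.aisle n X :=
  ((H.tStructure.isLE_iff_orthogonal n (n + 1) rfl X).2 fun Y f hY => h Y hY.ge f).le

theorem coaisle_of_hom_eq_zero {n : ℤ} {X : D}
    (h : ∀ Y : D, H.aisle (n - 1) Y → ∀ f : Y ⟶ X, f = 0) : H.coaisle n X :=
  ((H.tStructure.isGE_iff_orthogonal (n - 1) n (by lia) X).2 fun Y f hY => h Y hY.le f).ge

theorem aisle_mid {n : ℤ} {A X B : D} (h : IsExt A X B) (hA : H.aisle n A) (hB : H.aisle n B) :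
    H.aisle n X :=
  aisle_of_hom_eq_zero fun _ hY => h.hom_from_mid_eq_zero (hom_eq_zero (by lia) hA hY)
    (hom_eq_zero (by lia) hB hY)

theorem coaisle_mid {n : ℤ} {A X B : D} (h : IsExt A X B) (hA : H.coaisle n A)
    (hB : H.coaisle n B) : H.coaisle n X :=
  coaisle_of_hom_eq_zero fun _ hY => h.hom_to_mid_eq_zero (hom_eq_zero (by lia) hY hA)
    (hom_eq_zero (by lia) hY hB)

theorem aisle_right {n : ℤ} {A X B : D} (h : IsExt A X B) (hA : H.aisle (n + 1) A)
    (hX : H.aisle n X) : H.aisle n B :=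
  aisle_mid h.rot hX ((aisle_shift_iff (n + 1) 1 n (by lia)).2 hA)

theorem coaisle_left {n : ℤ} {A X B : D} (h : IsExt A X B) (hX : H.coaisle n X)
    (hB : H.coaisle (n - 1) B) : H.coaisle n A :=
  coaisle_mid h.inv_rot ((coaisle_shift_iff (n - 1) (-1) n (by lia)).2 hB) hX

theorem obj_mid {A X B : D} (h : IsExt A X B) (hA : H.obj A) (hB : H.obj B) : H.obj X :=
  ⟨aisle_mid h hA.1 hB.1, coaisle_mid h hA.2 hB.2⟩

variable (H) in
theorem exists_truncation (X : D) (m n : ℤ) (h : m + 1 = n) :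
    ∃ A B, IsExt A X B ∧ H.aisle m A ∧ H.coaisle n B := by
  obtain ⟨A, B, hA, hB, f, g, k, hT⟩ := H.tStructure.exists_triangle X m n h
  exact ⟨A, B, ⟨f, g, k, hT⟩, hA, hB⟩

variable (H) in
theorem exists_bounds (X : D) : ∃ m n : ℤ, H.coaisle m X ∧ H.aisle n X := by
  obtain ⟨⟨m, hm⟩, ⟨n, hn⟩⟩ := H.bounded X
  exact ⟨m, n, hm.ge, hn.le⟩

/-- If the middle term of a short exact sequence in the heart is zero, so are the outer terms. -/
theorem isZero_left_right {A X B : D} (h : IsExt A X B) (hA : H.obj A) (hB : H.obj B)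
    (hX : IsZero X) : IsZero A ∧ IsZero B := by
  obtain ⟨e⟩ := h.rot.iso_of_isZero_left hX
  have hA1 : H.aisle (-1) (A⟦(1 : ℤ)⟧) := (aisle_shift_iff 0 1 (-1) (by lia)).2 hA.1
  have hB0 := isZero_of_aisle_of_coaisle (by lia) (aisle_of_iso e.symm hA1) hB.2
  exact ⟨by obtain ⟨e'⟩ := h.iso_of_isZero_right hB0; exact hX.of_iso e', hB0⟩

section Octahedral

variable [IsTriangulated D]

/-- The image factorization of a morphism in the heart. -/
theorem exists_image {X Y : D} (hX : H.obj X) (hY : H.obj Y) (f : X ⟶ Y) :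
    ∃ K I Q, H.obj K ∧ H.obj I ∧ H.obj Q ∧ IsExt K X I ∧ IsExt I Y Q ∧ (IsZero I → f = 0) := by
  obtain ⟨C, g, k, hT⟩ := distinguished_cocone_triangle f
  obtain ⟨P, W, hPW, hP, hW⟩ := H.exists_truncation C (-1) 0 (by lia)
  obtain ⟨V, h1, h2, h3⟩ := IsExt.exists_factorization hT hPW
  have hV : H.obj V := ⟨aisle_mid h1 hX.1 (aisle_mono (by lia) hP),
    coaisle_left h2 hY.2 (coaisle_anti (by lia) hW)⟩
  refine ⟨P⟦(-1 : ℤ)⟧, V, W, ⟨(aisle_shift_iff (-1) (-1) 0 (by lia)).2 hP, ?_⟩, hV,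
    ⟨aisle_right h2 (aisle_mono (by lia) hV.1) hY.1, hW⟩, h1.inv_rot, h2, h3⟩
  exact coaisle_left h1.inv_rot hX.2 (coaisle_anti (by lia) hV.2)

/-- The `3 × 3` lemma in the heart: given subobjects `A` and `A'` of `X` with quotients `B` and
`B'`, the object `P` plays the role of `A ∩ A'`, and `U = A' / P`, `V = A / P`,
`W = X / (A + A')`. -/
theorem exists_refinement {X A B A' B' : D} (hA : H.obj A) (hB : H.obj B) (hA' : H.obj A')
    (hB' : H.obj B') (h : IsExt A X B) (h' : IsExt A' X B') :
    ∃ P U V W, H.obj P ∧ H.obj U ∧ H.obj V ∧ H.obj W ∧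
      IsExt P A V ∧ IsExt V B' W ∧ IsExt P A' U ∧ IsExt U B W := by
  obtain ⟨C, hC, hC'⟩ := h.exists_common_cone h'
  obtain ⟨P, W, hPW, hP, hW⟩ := H.exists_truncation C (-1) 0 (by lia)
  obtain ⟨V, hV1, hV2⟩ := hC.assoc hPW
  obtain ⟨U, hU1, hU2⟩ := hC'.assoc hPW
  have hV : H.obj V := ⟨aisle_mid hV1 hA.1 (aisle_mono (by lia) hP),
    coaisle_left hV2 hB'.2 (coaisle_anti (by lia) hW)⟩
  have hU : H.obj U := ⟨aisle_mid hU1 hA'.1 (aisle_mono (by lia) hP),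
    coaisle_left hU2 hB.2 (coaisle_anti (by lia) hW)⟩
  exact ⟨P⟦(-1 : ℤ)⟧, U, V, W, ⟨(aisle_shift_iff (-1) (-1) 0 (by lia)).2 hP,
    coaisle_left hV1.inv_rot hA.2 (coaisle_anti (by lia) hV.2)⟩, hU, hV,
    ⟨aisle_right hV2 (aisle_mono (by lia) hV.1) hB'.1, hW⟩, hV1.inv_rot, hV2, hU1.inv_rot, hU2⟩

/-- A subobject of a subobject is a subobject. -/
theorem exists_sub_sub {A X B A₁ A₂ : D} (h : IsExt A X B) (h' : IsExt A₁ A A₂)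
    (hB : H.obj B) (hA₂ : H.obj A₂) : ∃ Y, H.obj Y ∧ IsExt A₁ X Y ∧ IsExt A₂ Y B := by
  obtain ⟨Y, h1, h2⟩ := h.assoc' h'
  exact ⟨Y, obj_mid h2 hA₂ hB, h1, h2⟩

end Octahedral

/-! ### Hearts between a heart and its shift -/

section Intermediate

variable {K L : BoundedHeart D} {X : D}

theorem coaisle_of_le (h : H ≤ K) {n : ℤ} (hX : H.coaisle n X) : K.coaisle n X := by
  rw [← coaisle_shift_iff n (n - 1) 1 (by lia)] at hX ⊢
  exact h _ hX

theorem aisle_of_le (h : H ≤ K) {n : ℤ} (hX : K.aisle n X) : H.aisle n X :=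
  aisle_of_hom_eq_zero fun _ hY => hom_eq_zero (by lia) hX (coaisle_of_le h hY)

theorem coaisle_of_le_shift (h : K ≤ H.shift) {m n : ℤ} (hmn : m + 1 = n)
    (hX : K.coaisle n X) : H.coaisle m X := by
  obtain rfl : m = n - 1 := by lia
  exact coaisle_of_le h hX

theorem aisle_of_le_shift (h : K ≤ H.shift) {m n : ℤ} (hmn : m + 1 = n)
    (hX : H.aisle m X) : K.aisle n X := by
  obtain rfl : m = n - 1 := by lia
  exact aisle_of_le h hX

theorem shift_le_shift (h : H ≤ K) : H.shift ≤ K.shift := fun _ hX => coaisle_of_le h hX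

theorem le_shift_self : H ≤ H.shift := fun _ hX =>
  coaisle_anti (H := H) (m := 1 - 1) (n := 1) (by lia) hX

theorem obj_eq_of_le_of_le (h : H ≤ K) (h' : K ≤ H) : H.obj = K.obj := by
  ext X
  exact ⟨fun hX => ⟨aisle_of_le h' hX.1, coaisle_of_le h hX.2⟩,
    fun hX => ⟨aisle_of_le h hX.1, coaisle_of_le h' hX.2⟩⟩

/-- The torsion-free class in `H` of the heart `K`, for `H ≤ K ≤ H[1]`. -/
def free (H K : BoundedHeart D) : ObjectProperty D := fun X => H.obj X ∧ K.coaisle 1 X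

/-- The torsion class in `H` of the heart `K`, for `H ≤ K ≤ H[1]`. -/
def torsion (H K : BoundedHeart D) : ObjectProperty D := fun X => H.obj X ∧ K.aisle 0 X

theorem free_of_iso {X Y : D} (e : X ≅ Y) (h : H.free K X) : H.free K Y :=
  ⟨obj_of_iso e h.1, coaisle_of_iso e h.2⟩

theorem torsion_of_iso {X Y : D} (e : X ≅ Y) (h : H.torsion K X) : H.torsion K Y :=
  ⟨obj_of_iso e h.1, aisle_of_iso e h.2⟩

theorem isZero_of_torsion_of_free (h : H.torsion K X) (h' : H.free K X) : IsZero X :=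
  isZero_of_aisle_of_coaisle (by lia) h.2 h'.2

theorem free_mid {A B : D} (h : IsExt A X B) (hA : H.free K A) (hB : H.free K B) :
    H.free K X :=
  ⟨obj_mid h hA.1 hB.1, coaisle_mid h hA.2 hB.2⟩

theorem free_sub (hHK : H ≤ K) {A B : D} (h : IsExt A X B) (hA : H.obj A) (hB : H.obj B)
    (hX : K.coaisle 1 X) : H.free K A :=
  ⟨hA, coaisle_left h hX (coaisle_of_le hHK hB.2)⟩

theorem torsion_quotient (hKH : K ≤ H.shift) {A B : D} (h : IsExt A X B) (hA : H.obj A)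
    (hB : H.obj B) (hX : K.aisle 0 X) : H.torsion K B :=
  ⟨hB, aisle_right h (aisle_of_le_shift hKH (by lia) hA.1) hX⟩

/-- The torsion pair in `H` that belongs to `K`. -/
theorem exists_torsion_free (hHK : H ≤ K) (hKH : K ≤ H.shift) (hX : H.obj X) :
    ∃ t f, IsExt t X f ∧ H.torsion K t ∧ H.free K f := by
  obtain ⟨t, f, h, ht, hf⟩ := K.exists_truncation X 0 1 (by lia)
  have ht' : H.aisle 0 t := aisle_of_le hHK ht
  have hf' : H.coaisle 0 f := coaisle_of_le_shift hKH (by lia) hf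
  exact ⟨t, f, h, ⟨⟨ht', coaisle_left h hX.2 (coaisle_anti (by lia) hf')⟩, ht⟩,
    ⟨⟨aisle_right h (aisle_mono (by lia) ht') hX.1, hf'⟩, hf⟩⟩

theorem obj_of_torsion (hHK : H ≤ K) (hX : H.torsion K X) : K.obj X :=
  ⟨hX.2, coaisle_of_le hHK hX.1.2⟩

theorem obj_shift_of_free (hKH : K ≤ H.shift) (hX : H.free K X) : K.obj (X⟦(1 : ℤ)⟧) :=
  ⟨aisle_of_le_shift hKH (m := -1) (by lia) ((aisle_shift_iff 0 1 (-1) (by lia)).2 hX.1.1),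
    (coaisle_shift_iff 1 1 0 (by lia)).2 hX.2⟩

/-- The objects of `K` are extensions of torsion objects by shifted torsion-free objects of
`H`. -/
theorem exists_ext_of_obj (hHK : H ≤ K) (hKH : K ≤ H.shift) (hX : K.obj X) :
    ∃ f t, IsExt (f⟦(1 : ℤ)⟧) X t ∧ H.free K f ∧ H.torsion K t := by
  obtain ⟨A, t, h, hA, ht⟩ := H.exists_truncation X (-1) 0 (by lia)
  have hX0 : H.aisle 0 X := aisle_of_le hHK hX.1
  have hX1 : H.coaisle (-1) X := coaisle_of_le_shift hKH (by lia) hX.2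
  have ht' : H.torsion K t := ⟨⟨aisle_right h (aisle_mono (by lia) hA) hX0, ht⟩,
    aisle_right h (aisle_of_le_shift hKH (m := 0) (by lia) (aisle_mono (by lia) hA)) hX.1⟩
  have hA1 : H.coaisle (-1) A := coaisle_left h hX1 (coaisle_anti (by lia) ht)
  have hA2 : K.coaisle 0 A := coaisle_left h hX.2 (coaisle_of_le hHK (coaisle_anti (by lia) ht))
  exact ⟨A⟦(-1 : ℤ)⟧, t, h.of_iso ((shiftEquiv D (1 : ℤ)).counitIso.app A).symm (Iso.refl _)
    (Iso.refl _), ⟨⟨(aisle_shift_iff (-1) (-1) 0 (by lia)).2 hA,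
    (coaisle_shift_iff (-1) (-1) 0 (by lia)).2 hA1⟩,
    (coaisle_shift_iff 0 (-1) 1 (by lia)).2 hA2⟩, ht'⟩

/-- Intermediate hearts are ordered by their torsion-free classes. -/
theorem le_of_free_le (hHK : H ≤ K) (hKH : K ≤ H.shift) (hHL : H ≤ L)
    (h : H.free K ≤ H.free L) : K ≤ L := by
  intro X hX
  obtain ⟨A, B, hT, hA, hB⟩ := H.exists_truncation X 0 1 (by lia)
  have hX0 : H.coaisle 0 X := coaisle_of_le_shift hKH (by lia) hX
  have hA' : H.free K A := ⟨⟨hA, coaisle_left hT hX0 (coaisle_anti (by lia) hB)⟩,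
    coaisle_left hT hX (coaisle_of_le hHK (coaisle_anti (by lia) hB))⟩
  exact coaisle_mid hT (h _ hA').2 (coaisle_of_le hHL hB)

theorem free_le_of_le (h : K ≤ L) : H.free K ≤ H.free L := fun _ hX => ⟨hX.1, h _ hX.2⟩

/-- A nonzero torsion-free object that witnesses `L < K`. -/
theorem exists_free_of_not_le (hLK : L ≤ K) (hKL : K ≤ L.shift) (h : ¬ K ≤ L) :
    ∃ X, L.free K X ∧ ¬ IsZero X := by
  by_contra! hc
  exact h (le_of_free_le hLK hKL le_rfl fun X hX => ⟨hX.1, coaisle_of_isZero (hc X hX) 1⟩)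

end Intermediate

end BoundedHeart

end HeartBasics

/-! ### The Euler characteristic of an additive function on the heart -/

section EulerCharacteristic

variable {D : Type u} [Category.{v} D] [Preadditive D] [HasZeroObject D] [HasShift D ℤ]
  [∀ n : ℤ, (shiftFunctor D n).Additive] [Pretriangulated D]

namespace BoundedHeart

variable {H : BoundedHeart D}

/-- Induction on the amplitude: every object is obtained from zero by finitely many extensions by
shifted objects of the heart, of increasing degree. -/
theorem amplitude_induction {C : D → Prop} (zero : ∀ X, IsZero X → C X)
    (ext : ∀ (A X Q : D) (b : ℤ), IsExt A X Q → H.aisle (b - 1) A → H.aisle b Q →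
      H.coaisle b Q → C A → C X) (X : D) : C X := by
  obtain ⟨m, n, hm, hn⟩ := H.exists_bounds X
  have key : ∀ (k : ℕ) (X : D), H.coaisle m X → H.aisle (m + k - 1) X → C X := by
    intro k
    induction k with
    | zero => exact fun X h1 h2 => zero X (isZero_of_aisle_of_coaisle (by simp) h2 h1)
    | succ k ih =>
      intro X h1 h2
      obtain ⟨A, Q, h, hA, hQ⟩ := H.exists_truncation X (m + k - 1) (m + k) (by lia)
      exact ext A X Q (m + k) h hA
        (aisle_right h (aisle_mono (by lia) hA) (aisle_mono (by lia) h2)) hQ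
        (ih A (coaisle_left h h1 (coaisle_anti (by lia) hQ)) hA)
  exact key (n - m + 1).toNat X hm (aisle_mono (by lia) hn)

variable (H) in
/-- An integer-valued function on objects that is additive on the short exact sequences of the
heart of `H`. -/
structure IsAdditive (φ : D → ℤ) : Prop where
  ext : ∀ {A X B : D}, H.obj A → H.obj B → IsExt A X B → φ X = φ A + φ B

namespace IsAdditive

variable {φ : D → ℤ}

theorem isZero (hφ : H.IsAdditive φ) {X : D} (hX : IsZero X) : φ X = 0 := by
  simpa using hφ.ext (obj_of_isZero hX) (obj_of_isZero hX) (IsExt.zero_left X hX)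

theorem iso (hφ : H.IsAdditive φ) {X Y : D} (e : X ≅ Y) (hX : H.obj X) : φ X = φ Y := by
  have h := hφ.ext (obj_of_isZero (isZero_zero D)) hX
    ((IsExt.zero_left X (isZero_zero D)).of_iso (Iso.refl _) e (Iso.refl _))
  rw [hφ.isZero (isZero_zero D), zero_add] at h
  exact h.symm

end IsAdditive

variable (H) in
/-- The value of `φ` on the `i`-th cohomology object. -/
noncomputable def cohomologyValue (φ : D → ℤ) (i : ℤ) (X : D) : ℤ :=
  φ (((H.tStructure.truncGELT i (i + 1)).obj X)⟦i⟧)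

variable (H) in
/-- The alternating sum of the values of `φ` on the cohomology objects. -/
noncomputable def eulerCharacteristic (φ : D → ℤ) (X : D) : ℤ :=
  ∑ᶠ i : ℤ, (i.negOnePow : ℤ) * H.cohomologyValue φ i X

variable {φ : D → ℤ}

theorem cohomologyValue_of_aisle (hφ : H.IsAdditive φ) {i m : ℤ} (hi : m < i) {X : D}
    (hX : H.aisle m X) : H.cohomologyValue φ i X = 0 := by
  refine hφ.isZero (Functor.map_isZero _ ?_)
  have : H.tStructure.IsLE X (i - 1) := ⟨aisle_mono (by lia) hX⟩
  have : H.tStructure.IsLE ((H.tStructure.truncLT (i + 1)).obj X) (i - 1) := inferInstance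
  exact H.tStructure.isZero_truncGE_obj_of_isLE (i - 1) i (by lia) _

theorem cohomologyValue_of_coaisle (hφ : H.IsAdditive φ) {i m : ℤ} (hi : i < m) {X : D}
    (hX : H.coaisle m X) : H.cohomologyValue φ i X = 0 := by
  refine hφ.isZero (Functor.map_isZero _ (Functor.map_isZero (H.tStructure.truncGE i) ?_))
  have : H.tStructure.IsGE X (i + 1) := ⟨coaisle_anti (by lia) hX⟩
  exact H.tStructure.isZero_truncLT_obj_of_isGE (i + 1) X

theorem finite_support_cohomologyValue (hφ : H.IsAdditive φ) (X : D) :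
    (Function.support fun i : ℤ => (i.negOnePow : ℤ) * H.cohomologyValue φ i X).Finite := by
  obtain ⟨m, n, hm, hn⟩ := H.exists_bounds X
  refine (Set.finite_Icc m n).subset fun i hi => ?_
  by_contra hc
  rw [Set.mem_Icc, not_and_or, not_le, not_le] at hc
  apply hi
  rcases hc with hc | hc
  · simp [cohomologyValue_of_coaisle hφ hc hm]
  · simp [cohomologyValue_of_aisle hφ hc hn]

theorem eulerCharacteristic_of_isZero (hφ : H.IsAdditive φ) {X : D} (hX : IsZero X) :
    H.eulerCharacteristic φ X = 0 := by
  have : ∀ i, (i.negOnePow : ℤ) * H.cohomologyValue φ i X = 0 := fun i => by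
    rw [cohomologyValue_of_aisle hφ (Int.sub_one_lt_of_le le_rfl) (aisle_of_isZero hX _), mul_zero]
  simp [eulerCharacteristic, this]

variable [IsTriangulated D]

theorem obj_truncGELT_shift (i : ℤ) (X : D) :
    H.obj (((H.tStructure.truncGELT i (i + 1)).obj X)⟦i⟧) := by
  refine ⟨(aisle_shift_iff i i 0 (by lia)).2 ?_, (coaisle_shift_iff i i 0 (by lia)).2 ?_⟩
  · have : H.tStructure.IsLE ((H.tStructure.truncGELT i (i + 1)).obj X) (i + 1 - 1) := inferInstance
    exact aisle_mono (m := i + 1 - 1) (by lia) this.le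
  · have : H.tStructure.IsGE ((H.tStructure.truncGELT i (i + 1)).obj X) i := inferInstance
    exact this.ge

theorem cohomologyValue_iso (hφ : H.IsAdditive φ) {i : ℤ} {X Y : D}
    (e : (H.tStructure.truncGELT i (i + 1)).obj X ≅ (H.tStructure.truncGELT i (i + 1)).obj Y) :
    H.cohomologyValue φ i X = H.cohomologyValue φ i Y :=
  hφ.iso ((shiftFunctor D i).mapIso e) (obj_truncGELT_shift i X)

theorem cohomologyValue_ext (hφ : H.IsAdditive φ) {A X B : D} {m : ℤ} (h : IsExt A X B)
    (hA : H.aisle m A) (hB : H.coaisle (m + 1) B) (i : ℤ) :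
    H.cohomologyValue φ i X = H.cohomologyValue φ i A + H.cohomologyValue φ i B := by
  obtain ⟨f, g, k, hT⟩ := h
  rcases lt_or_ge m i with hi | hi
  · rw [cohomologyValue_of_aisle hφ hi hA, zero_add]
    have : IsIso ((H.tStructure.truncGE i).map g) :=
      H.tStructure.isIso₂_truncGE_map_of_isLE _ hT (i - 1) i (by lia) ⟨aisle_mono (by lia) hA⟩
    refine cohomologyValue_iso hφ ((H.tStructure.truncGELTIsoLTGE i (i + 1)).app X ≪≫
      (H.tStructure.truncLT (i + 1)).mapIso (asIso ((H.tStructure.truncGE i).map g)) ≪≫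
      ((H.tStructure.truncGELTIsoLTGE i (i + 1)).app B).symm)
  · rw [cohomologyValue_of_coaisle hφ (by lia) hB, add_zero]
    have : IsIso ((H.tStructure.truncLT (i + 1)).map f) :=
      H.tStructure.isIso₁_truncLT_map_of_isGE _ hT (i + 1) ⟨coaisle_anti (by lia) hB⟩
    exact (cohomologyValue_iso hφ ((H.tStructure.truncGE i).mapIso
      (asIso ((H.tStructure.truncLT (i + 1)).map f)))).symm

theorem cohomologyValue_of_concentrated (hφ : H.IsAdditive φ) {b : ℤ} {Q : D}
    (h1 : H.aisle b Q) (h2 : H.coaisle b Q) : H.cohomologyValue φ b Q = φ (Q⟦b⟧) := by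
  have : H.tStructure.IsLE Q (b + 1 - 1) := ⟨aisle_mono (by lia) h1⟩
  have : H.tStructure.IsGE Q b := ⟨h2⟩
  have i1 : IsIso ((H.tStructure.truncLTι (b + 1)).app Q) :=
    (H.tStructure.isLE_iff_isIso_truncLTι_app (b + 1 - 1) (b + 1) (by lia) Q).1 inferInstance
  refine hφ.iso ((shiftFunctor D b).mapIso ((H.tStructure.truncGE b).mapIso
    (asIso ((H.tStructure.truncLTι (b + 1)).app Q)) ≪≫
    (asIso ((H.tStructure.truncGEπ b).app Q)).symm)) (obj_truncGELT_shift b Q)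

theorem eulerCharacteristic_truncation (hφ : H.IsAdditive φ) {A X B : D} {m n : ℤ}
    (h : IsExt A X B) (hmn : m < n) (hA : H.aisle m A) (hB : H.coaisle n B) :
    H.eulerCharacteristic φ X = H.eulerCharacteristic φ A + H.eulerCharacteristic φ B := by
  rw [eulerCharacteristic, eulerCharacteristic, eulerCharacteristic,
    ← finsum_add_distrib (finite_support_cohomologyValue hφ A)
      (finite_support_cohomologyValue hφ B)]
  refine finsum_congr fun i => ?_
  rw [cohomologyValue_ext hφ h hA (coaisle_anti (by lia) hB), mul_add]

theorem eulerCharacteristic_of_concentrated (hφ : H.IsAdditive φ) {b : ℤ} {Q : D}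
    (h1 : H.aisle b Q) (h2 : H.coaisle b Q) :
    H.eulerCharacteristic φ Q = b.negOnePow * φ (Q⟦b⟧) := by
  rw [eulerCharacteristic, finsum_eq_single _ b, cohomologyValue_of_concentrated hφ h1 h2]
  intro i hi
  rcases lt_or_gt_of_ne hi with hi | hi
  · rw [cohomologyValue_of_coaisle hφ hi h2, mul_zero]
  · rw [cohomologyValue_of_aisle hφ hi h1, mul_zero]

theorem eulerCharacteristic_of_obj (hφ : H.IsAdditive φ) {X : D} (hX : H.obj X) :
    H.eulerCharacteristic φ X = φ X := by
  rw [eulerCharacteristic_of_concentrated hφ hX.1 hX.2, Int.negOnePow_zero, Units.val_one, one_mul]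
  exact (hφ.iso ((shiftFunctorZero D ℤ).app X).symm hX).symm

theorem eulerCharacteristic_iso (hφ : H.IsAdditive φ) {X Y : D} (e : X ≅ Y) :
    H.eulerCharacteristic φ X = H.eulerCharacteristic φ Y := by
  obtain ⟨m, n, hm, hn⟩ := H.exists_bounds X
  have := eulerCharacteristic_truncation hφ ((IsExt.zero_right X (isZero_zero D)).of_iso
    (Iso.refl _) e (Iso.refl _)) (Int.lt_add_one_of_le le_rfl) hn
    (coaisle_of_isZero (isZero_zero D) _)
  rw [this, eulerCharacteristic_of_isZero hφ (isZero_zero D), add_zero]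

theorem eulerCharacteristic_shift_one (hφ : H.IsAdditive φ) (X : D) :
    H.eulerCharacteristic φ (X⟦(1 : ℤ)⟧) = -H.eulerCharacteristic φ X := by
  induction X using amplitude_induction (H := H) with
  | zero X hX =>
    rw [eulerCharacteristic_of_isZero hφ hX,
      eulerCharacteristic_of_isZero hφ (Functor.map_isZero _ hX), neg_zero]
  | ext A X Q b h hA hQ hQ' ih =>
    have hQ1 : H.aisle (b - 1) (Q⟦(1 : ℤ)⟧) := (aisle_shift_iff b 1 _ (by lia)).2 hQ
    have hQ2 : H.coaisle (b - 1) (Q⟦(1 : ℤ)⟧) := (coaisle_shift_iff b 1 _ (by lia)).2 hQ'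
    have hQb : H.obj (Q⟦b⟧) := ⟨(aisle_shift_iff b b 0 (by lia)).2 hQ,
      (coaisle_shift_iff b b 0 (by lia)).2 hQ'⟩
    have hs : φ (Q⟦(1 : ℤ)⟧⟦b - 1⟧) = φ (Q⟦b⟧) :=
      (hφ.iso ((shiftFunctorAdd' D 1 (b - 1) b (by lia)).app Q) hQb).symm
    rw [eulerCharacteristic_truncation hφ h (by lia) hA hQ',
      eulerCharacteristic_truncation hφ (h.shift 1) (m := b - 2) (n := b - 1) (by lia)
        ((aisle_shift_iff (b - 1) 1 _ (by lia)).2 hA) hQ2, ih,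
      eulerCharacteristic_of_concentrated hφ hQ1 hQ2,
      eulerCharacteristic_of_concentrated hφ hQ hQ', hs]
    have : ((b - 1).negOnePow : ℤ) = -(b.negOnePow : ℤ) := by
      have h' := Int.negOnePow_succ (b - 1)
      rw [sub_add_cancel] at h'
      rw [h']
      simp
    rw [this]
    ring

theorem eulerCharacteristic_shift_neg_one (hφ : H.IsAdditive φ) (X : D) :
    H.eulerCharacteristic φ (X⟦(-1 : ℤ)⟧) = -H.eulerCharacteristic φ X := by
  rw [← neg_eq_iff_eq_neg, ← eulerCharacteristic_shift_one hφ]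
  exact eulerCharacteristic_iso hφ ((shiftEquiv D (1 : ℤ)).counitIso.app X)

/-- Removing the top cohomology of the third term of a triangle, together with its preimage in
the second term, does not change the defect of additivity of the Euler characteristic. -/
theorem exists_peeled_triangle (hφ : H.IsAdditive φ) {X Y Z : D} {b : ℤ} (h : IsExt X Y Z)
    (hX : H.aisle b X) (hZ : H.aisle b Z) :
    ∃ Y' Z', IsExt X Y' Z' ∧ H.aisle b Y' ∧ H.aisle (b - 1) Z' ∧
      (∀ n ≤ b + 1, H.coaisle n Y → H.coaisle n Y') ∧
      (∀ n ≤ b + 1, H.coaisle n Z → H.coaisle n Z') ∧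
      H.eulerCharacteristic φ Y - H.eulerCharacteristic φ Z =
        H.eulerCharacteristic φ Y' - H.eulerCharacteristic φ Z' := by
  obtain ⟨Z', Q, hZQ, hZ', hQ⟩ := H.exists_truncation Z (b - 1) b (by lia)
  have hQ' : H.aisle b Q := aisle_right hZQ (aisle_mono (by lia) hZ') hZ
  obtain ⟨Y', h1, h2⟩ := h.assoc hZQ
  have hY' : H.aisle b Y' := aisle_mid h1 hX (aisle_mono (by lia) hZ')
  refine ⟨Y', Z', h1, hY', hZ', fun n hn hY => coaisle_left h2 hY (coaisle_anti (by lia) hQ),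
    fun n hn hZ => coaisle_left hZQ hZ (coaisle_anti (by lia) hQ), ?_⟩
  obtain ⟨P, R, hPR, hP, hR⟩ := H.exists_truncation Y' (b - 1) b (by lia)
  have hR' : H.aisle b R := aisle_right hPR (aisle_mono (by lia) hP) hY'
  obtain ⟨W, h3, h4⟩ := h2.assoc' hPR
  have hsh : ∀ {V : D}, H.aisle b V → H.coaisle b V → H.obj (V⟦b⟧) := fun hV hV' =>
    ⟨(aisle_shift_iff b b 0 (by lia)).2 hV, (coaisle_shift_iff b b 0 (by lia)).2 hV'⟩
  rw [eulerCharacteristic_truncation hφ hZQ (by lia) hZ' hQ,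
    eulerCharacteristic_truncation hφ h3 (by lia) hP (coaisle_mid h4 hR hQ),
    eulerCharacteristic_truncation hφ hPR (by lia) hP hR,
    eulerCharacteristic_of_concentrated hφ (aisle_mid h4 hR' hQ') (coaisle_mid h4 hR hQ),
    eulerCharacteristic_of_concentrated hφ hR' hR,
    eulerCharacteristic_of_concentrated hφ hQ' hQ,
    hφ.ext (hsh hR' hR) (hsh hQ' hQ) (h4.shift b)]
  ring

/-- The Euler characteristic is additive on distinguished triangles. The proof is by induction on
the range of degrees in which the three terms live: peeling off the top cohomology does not change
the defect of additivity, and rotating the triangle brings each term into the position in which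
`exists_peeled_triangle` lowers its top degree. -/
theorem eulerCharacteristic_ext (hφ : H.IsAdditive φ) {X Y Z : D} (h : IsExt X Y Z) :
    H.eulerCharacteristic φ Y = H.eulerCharacteristic φ X + H.eulerCharacteristic φ Z := by
  obtain ⟨a₁, b₁, ha₁, hb₁⟩ := H.exists_bounds X
  obtain ⟨a₂, b₂, ha₂, hb₂⟩ := H.exists_bounds Y
  obtain ⟨a₃, b₃, ha₃, hb₃⟩ := H.exists_bounds Z
  obtain ⟨a, h1, h2, h3⟩ : ∃ a, a ≤ a₁ ∧ a ≤ a₂ ∧ a ≤ a₃ :=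
    ⟨min a₁ (min a₂ a₃), by lia, by lia, by lia⟩
  have key : ∀ (k : ℕ) (X Y Z : D), IsExt X Y Z → H.coaisle a X → H.coaisle a Y →
      H.coaisle a Z → H.aisle (a + k - 1) X → H.aisle (a + k - 1) Y → H.aisle (a + k - 1) Z →
      H.eulerCharacteristic φ Y = H.eulerCharacteristic φ X + H.eulerCharacteristic φ Z := by
    intro k
    induction k with
    | zero =>
      intro X Y Z h aX aY aZ bX bY bZ
      rw [eulerCharacteristic_of_isZero hφ (isZero_of_aisle_of_coaisle (by simp) bX aX),
        eulerCharacteristic_of_isZero hφ (isZero_of_aisle_of_coaisle (by simp) bY aY),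
        eulerCharacteristic_of_isZero hφ (isZero_of_aisle_of_coaisle (by simp) bZ aZ), add_zero]
    | succ k ih =>
      intro X Y Z h aX aY aZ bX bY bZ
      obtain ⟨b, hb⟩ : ∃ b, b = a + k := ⟨_, rfl⟩
      have hb' : a + ((k + 1 : ℕ) : ℤ) - 1 = b := by push_cast; lia
      rw [hb'] at bX bY bZ
      rw [show a + (k : ℤ) - 1 = b - 1 by lia] at ih
      have shift_aisle : ∀ {V : D}, H.aisle (b - 1) V → H.aisle b (V⟦(-1 : ℤ)⟧) :=
        fun hV => (aisle_shift_iff (b - 1) (-1) b (by lia)).2 hV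
      have shift_coaisle : ∀ {V : D}, H.coaisle a V → H.coaisle (a + 1) (V⟦(-1 : ℤ)⟧) :=
        fun hV => (coaisle_shift_iff a (-1) (a + 1) (by lia)).2 hV
      -- Lower the top degree of the three terms in turn, rotating the triangle in between.
      obtain ⟨Y₁, Z₁, t₁, bY₁, bZ₁, aY₁, aZ₁, e₁⟩ := exists_peeled_triangle hφ h bX bZ
      replace aY₁ := aY₁ a (by lia) aY
      replace aZ₁ := aZ₁ a (by lia) aZ
      obtain ⟨X₂, Y₂, t₂, bX₂, bY₂, aX₂, aY₂, e₂⟩ :=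
        exists_peeled_triangle hφ t₁.inv_rot (shift_aisle bZ₁) bY₁
      replace aX₂ := aX₂ a (by lia) aX
      replace aY₂ := aY₂ a (by lia) aY₁
      obtain ⟨Z₃, X₃, t₃, bZ₃, bX₃, aZ₃, aX₃, e₃⟩ :=
        exists_peeled_triangle hφ t₂.of_inv_rot.inv_rot.inv_rot (shift_aisle bY₂) bX₂
      replace aZ₃ := aZ₃ (a + 1) (by lia) (shift_coaisle aZ₁)
      replace aX₃ := aX₃ a (by lia) aX₂
      have e₄ := ih X₃ Y₂ (Z₃⟦(1 : ℤ)⟧) t₃.of_inv_rot.rot aX₃ aY₂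
        ((coaisle_shift_iff (a + 1) 1 a (by lia)).2 aZ₃) bX₃ bY₂
        ((aisle_shift_iff b 1 (b - 1) (by lia)).2 bZ₃)
      rw [eulerCharacteristic_shift_one hφ] at e₄
      rw [eulerCharacteristic_shift_neg_one hφ] at e₃
      linarith
  refine key (max b₁ (max b₂ b₃) - a + 1).toNat X Y Z h (coaisle_anti h1 ha₁)
    (coaisle_anti h2 ha₂) (coaisle_anti h3 ha₃) (aisle_mono ?_ hb₁) (aisle_mono ?_ hb₂)
    (aisle_mono ?_ hb₃)
  all_goals lia

/-- An additive function on the heart extends to `K(D)`. -/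
theorem IsAdditive.exists_extension (hφ : H.IsAdditive φ) :
    ∃ v : TriangulatedK D →+ ℤ, ∀ X, H.obj X → v (TriangulatedK.cls X) = φ X :=
  ⟨TriangulatedK.lift (H.eulerCharacteristic φ) (eulerCharacteristic_ext hφ), fun X hX => by
    rw [TriangulatedK.lift_cls, eulerCharacteristic_of_obj hφ hX]⟩

end BoundedHeart

end EulerCharacteristic

/-! ### Simple objects and finite filtrations -/

section SimpleObjects

variable {D : Type u} [Category.{v} D] [Preadditive D] [HasZeroObject D] [HasShift D ℤ]
  [∀ n : ℤ, (shiftFunctor D n).Additive] [Pretriangulated D]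

namespace BoundedHeart

variable {H : BoundedHeart D}

variable (H) in
/-- The simple objects of the heart, expressed through distinguished triangles. -/
structure IsSimpleObj (S : D) : Prop where
  obj : H.obj S
  not_isZero : ¬ IsZero S
  isZero_or : ∀ {A B : D}, H.obj A → H.obj B → IsExt A S B → IsZero A ∨ IsZero B

theorem IsSimpleObj.of_iso {S S' : D} (hS : H.IsSimpleObj S) (e : S ≅ S') : H.IsSimpleObj S' where
  obj := obj_of_iso e hS.obj
  not_isZero h := hS.not_isZero (h.of_iso e)
  isZero_or hA hB h := hS.isZero_or hA hB (h.of_iso (Iso.refl _) e.symm (Iso.refl _))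

variable (H) in
/-- The objects of the heart that have a finite filtration with simple factors. -/
inductive Filtered : D → Prop
  | zero (X : D) : IsZero X → Filtered X
  | ext (A X S : D) : IsExt A X S → Filtered A → H.IsSimpleObj S → Filtered X

theorem Filtered.obj {X : D} (h : H.Filtered X) : H.obj X := by
  induction h with
  | zero X hX => exact obj_of_isZero hX
  | ext A X S h _ hS ih => exact obj_mid h ih hS.obj

variable (H) in
/-- The heart is a length category. -/
def IsLength : Prop := ∀ X : D, H.obj X → H.Filtered X

theorem isZero_cat_iff {X : H.Cat} : IsZero X ↔ IsZero X.obj := by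
  rw [IsZero.iff_id_eq_zero, IsZero.iff_id_eq_zero]
  exact ⟨fun h => congrArg (fun f => f.hom) h, fun h => ObjectProperty.hom_ext _ h⟩

/-- The first morphism of a triangle with terms in the heart is a monomorphism of the heart. -/
theorem mono_homMk {A X : H.Cat} {B : D} {f : A.obj ⟶ X.obj} {g : X.obj ⟶ B}
    {k : B ⟶ A.obj⟦(1 : ℤ)⟧} (hT : Triangle.mk f g k ∈ distTriang D) (hB : H.obj B) :
    Mono (ObjectProperty.homMk f : A ⟶ X) := by
  refine (Preadditive.mono_iff_cancel_zero _).2 fun Z u hu => ?_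
  have hu' : u.hom ≫ f = 0 := congrArg (fun f => f.hom) hu
  exact ObjectProperty.hom_ext _ (IsExt.hom_eq_zero_of_comp hT (hom_eq_zero (by lia) Z.property.1
    ((coaisle_shift_iff 0 (-1) 1 (by lia)).2 hB.2)) hu')

/-- The cone of a monomorphism of the heart lies in the heart. -/
theorem obj_cone_of_mono {A X : H.Cat} (i : A ⟶ X) [Mono i] {B : D} {g : X.obj ⟶ B}
    {k : B ⟶ A.obj⟦(1 : ℤ)⟧} (hT : Triangle.mk i.hom g k ∈ distTriang D) : H.obj B := by
  have hA1 : H.coaisle (-1) (A.obj⟦(1 : ℤ)⟧) := (coaisle_shift_iff 0 1 (-1) (by lia)).2 A.property.2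
  have hB1 : H.coaisle (-1) B := coaisle_mid (IsExt.of_triangle hT).rot
    (coaisle_anti (by lia) X.property.2) hA1
  refine ⟨aisle_right (IsExt.of_triangle hT) (aisle_mono (by lia) A.property.1) X.property.1,
    coaisle_of_hom_eq_zero fun Y hY f => ?_⟩
  obtain ⟨Y', Q, hYQ, hY', hQ⟩ := H.exists_truncation Y (-2) (-1) (by lia)
  have hQ' : H.aisle (-1) Q := aisle_right hYQ (aisle_mono (by lia) hY') (by simpa using hY)
  refine hYQ.hom_from_mid_eq_zero (hom_eq_zero (by lia) hY' hB1) (fun q => ?_) f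
  -- `Q` is the shift of an object of the heart, so the composite `Q ⟶ B ⟶ A⟦1⟧` comes from a
  -- morphism to `A` that is killed by the monomorphism `i`.
  let Z : H.Cat := ⟨Q⟦(-1 : ℤ)⟧, (aisle_shift_iff (-1) (-1) 0 (by lia)).2 hQ',
    (coaisle_shift_iff (-1) (-1) 0 (by lia)).2 hQ⟩
  let e : Z.obj⟦(1 : ℤ)⟧ ≅ Q := (shiftEquiv D (1 : ℤ)).counitIso.app Q
  obtain ⟨u, hu⟩ := (shiftFunctor D (1 : ℤ)).map_surjective (e.hom ≫ q ≫ k)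
  have hui : u ≫ i.hom = 0 := (shiftFunctor D (1 : ℤ)).map_injective (by
    have : k ≫ i.hom⟦(1 : ℤ)⟧' = 0 := comp_distTriang_mor_zero₃₁ _ hT
    rw [Functor.map_comp, hu, Category.assoc, Category.assoc, this, Functor.map_zero]
    simp)
  have hu0 : (ObjectProperty.homMk u : Z ⟶ A) = 0 := by
    rw [← cancel_mono i, zero_comp]
    exact ObjectProperty.hom_ext _ hui
  have hu0' : u = 0 := congrArg (fun f => f.hom) hu0
  rw [hu0', Functor.map_zero] at hu
  have hqk : q ≫ k = 0 := by rw [← cancel_epi e.hom, ← hu, comp_zero]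
  obtain ⟨l, hl⟩ : ∃ l : Q ⟶ X.obj, q = l ≫ g := Triangle.coyoneda_exact₃ _ hT q hqk
  rw [hl, hom_eq_zero (by lia) hQ' X.property.2 l, zero_comp]

theorem exists_cone_of_mono {A X : H.Cat} (i : A ⟶ X) [Mono i] :
    ∃ (B : D) (g : X.obj ⟶ B) (k : B ⟶ A.obj⟦(1 : ℤ)⟧),
      Triangle.mk i.hom g k ∈ distTriang D ∧ H.obj B := by
  obtain ⟨B, g, k, hT⟩ := distinguished_cocone_triangle i.hom
  exact ⟨B, g, k, hT, obj_cone_of_mono i hT⟩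

theorem isIso_iff_isZero_cone {A X : H.Cat} (i : A ⟶ X) {B : D} {g : X.obj ⟶ B}
    {k : B ⟶ A.obj⟦(1 : ℤ)⟧} (hT : Triangle.mk i.hom g k ∈ distTriang D) :
    IsIso i ↔ IsZero B := by
  rw [← ObjectProperty.isIso_hom_iff]
  exact (Triangle.isZero₃_iff_isIso₁ _ hT).symm

/-- The simple objects in the triangulated sense are those of the heart as a category. -/
theorem simple_iff_isSimpleObj {S : H.Cat} : Simple S ↔ H.IsSimpleObj S.obj := by
  constructor
  · intro hS
    have hS0 : ¬ IsZero S.obj := fun h => Simple.not_isZero S (isZero_cat_iff.2 h)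
    refine ⟨S.property, hS0, fun {A B} hA hB ⟨f, g, k, hT⟩ => ?_⟩
    let A' : H.Cat := ⟨A, hA⟩
    have := mono_homMk (A := A') (X := S) hT hB
    by_cases h0 : (ObjectProperty.homMk f : A' ⟶ S) = 0
    · left
      refine isZero_cat_iff (X := A').1 ?_
      rw [IsZero.iff_id_eq_zero, ← cancel_mono (ObjectProperty.homMk f : A' ⟶ S), h0]
      simp
    · right
      exact (isIso_iff_isZero_cone _ hT).1 ((Simple.mono_isIso_iff_nonzero _).2 h0)
  · intro hS
    refine ⟨fun {Y} f _ => ?_⟩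
    obtain ⟨B, g, k, hT, hB⟩ := exists_cone_of_mono f
    rw [isIso_iff_isZero_cone f hT]
    constructor
    · rintro h0 rfl
      have := (isIso_iff_isZero_cone (0 : Y ⟶ S) hT).2 h0
      apply hS.not_isZero
      rw [← isZero_cat_iff, IsZero.iff_id_eq_zero, ← IsIso.inv_hom_id (0 : Y ⟶ S), comp_zero]
    · intro hf
      refine (hS.isZero_or Y.property hB ⟨_, _, _, hT⟩).resolve_left fun h0 => hf ?_
      exact (isZero_cat_iff.2 h0).eq_of_src _ _

variable [IsTriangulated D]

/-- A nonzero noetherian object of the heart has a simple quotient. -/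
theorem exists_simple_quotient {Y : H.Cat} [IsNoetherianObject Y] (hY : ¬ IsZero Y) :
    ∃ (Z : H.Cat) (i : Z ⟶ Y) (_ : Mono i) (S : D), H.IsSimpleObj S ∧
      IsExt Z.obj Y.obj S ∧ ¬ IsIso i := by
  obtain ⟨N, hN⟩ : ∃ N : H.Cat, IsZero N := by
    obtain ⟨N₀, hN₀⟩ := HasZeroObject.zero (C := D)
    exact ⟨⟨N₀, obj_of_isZero hN₀⟩, isZero_cat_iff.2 hN₀⟩
  have : Mono (0 : N ⟶ Y) := ⟨fun _ _ _ => hN.eq_of_tgt _ _⟩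
  have hne : {W : Subobject Y | W ≠ ⊤}.Nonempty := by
    refine ⟨Subobject.mk (0 : N ⟶ Y), fun h => hY ?_⟩
    have := (Subobject.isIso_iff_mk_eq_top (0 : N ⟶ Y)).2 h
    exact hN.of_iso (asIso (0 : N ⟶ Y)).symm
  obtain ⟨W, hW, hmax⟩ := (wellFounded_gt (α := Subobject Y)).has_min _ hne
  obtain ⟨B, g, k, hT, hB⟩ := exists_cone_of_mono W.arrow
  have hW' : ¬ IsIso W.arrow := fun h => hW ((Subobject.isIso_arrow_iff_eq_top W).1 h)
  have hB0 : ¬ IsZero B := fun h => hW' ((isIso_iff_isZero_cone _ hT).2 h)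
  refine ⟨(W : H.Cat), W.arrow, inferInstance, B, ⟨hB, hB0, fun {P Q} hP hQ ⟨p, q, r, hT'⟩ => ?_⟩,
    ⟨_, _, _, hT⟩, hW'⟩
  by_contra! hc
  -- The kernel of `Y ⟶ B ⟶ Q` is a proper subobject that contains `W`, hence equal to `W`, and
  -- so `q` is a split monomorphism.
  obtain ⟨V, j, m, hV⟩ := distinguished_cocone_triangle₁ (g ≫ q)
  have hV0 : H.obj V := obj_mid (IsExt.of_fibre_comp hT hT' hV) (W : H.Cat).property hP
  have hgW : W.arrow.hom ≫ g = 0 := comp_distTriang_mor_zero₁₂ _ hT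
  obtain ⟨l, hl⟩ : ∃ l : (W : H.Cat).obj ⟶ V, W.arrow.hom = l ≫ j :=
    Triangle.coyoneda_exact₂ _ hV _ (by
      change W.arrow.hom ≫ g ≫ q = 0
      rw [← Category.assoc, hgW, zero_comp])
  let V' : H.Cat := ⟨V, hV0⟩
  have hj : Mono (ObjectProperty.homMk j : V' ⟶ Y) := mono_homMk (A := V') hV hQ
  have hle : W ≤ Subobject.mk (ObjectProperty.homMk j : V' ⟶ Y) :=
    Subobject.le_mk_of_comm (ObjectProperty.homMk l) (ObjectProperty.hom_ext _ hl.symm)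
  have hVtop : Subobject.mk (ObjectProperty.homMk j : V' ⟶ Y) ≠ ⊤ := fun h =>
    hc.2 ((isIso_iff_isZero_cone _ hV).1 ((Subobject.isIso_iff_mk_eq_top _).2 h))
  have hWV : W = Subobject.mk (ObjectProperty.homMk j : V' ⟶ Y) :=
    hle.eq_of_not_lt (hmax _ hVtop)
  have hjg : j ≫ g = 0 := by
    have h1 : Subobject.ofMkLE _ _ hWV.ge ≫ W.arrow = ObjectProperty.homMk j :=
      Subobject.ofMkLE_arrow _
    have h2 : (Subobject.ofMkLE _ _ hWV.ge).hom ≫ W.arrow.hom = j :=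
      congrArg (fun f => f.hom) h1
    rw [← h2, Category.assoc, hgW, comp_zero]
  obtain ⟨s, hs⟩ : ∃ s : Q ⟶ B, g = (g ≫ q) ≫ s := Triangle.yoneda_exact₂ _ hV g hjg
  obtain ⟨t, ht⟩ : ∃ t : (W : H.Cat).obj⟦(1 : ℤ)⟧ ⟶ B, 𝟙 B - q ≫ s = k ≫ t :=
    Triangle.yoneda_exact₃ _ hT _ (by
      change g ≫ (𝟙 B - q ≫ s) = 0
      rw [Preadditive.comp_sub, Category.comp_id, ← Category.assoc, ← hs, sub_self])
  rw [hom_eq_zero (by lia) ((aisle_shift_iff 0 1 (-1) (by lia)).2 (W : H.Cat).property.1) hB.2 t,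
    comp_zero, sub_eq_zero] at ht
  have hp : p = 0 := by
    have hpq : p ≫ q = 0 := comp_distTriang_mor_zero₁₂ _ hT'
    rw [← Category.comp_id p, ht, ← Category.assoc, hpq, zero_comp]
  refine hc.1 ((IsZero.iff_id_eq_zero P).2 (IsExt.hom_eq_zero_of_comp hT' (hom_eq_zero (by lia) hP.1
    ((coaisle_shift_iff 0 (-1) 1 (by lia)).2 hQ.2)) ?_))
  rw [hp, comp_zero]

/-- A noetherian and artinian heart is a length category. -/
theorem IsAlgebraic.isLength (hH : H.IsAlgebraic) : H.IsLength := by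
  intro X hX
  have hN := hH.noetherian
  have hA := hH.artinian
  have key : ∀ (W : Subobject (⟨X, hX⟩ : H.Cat)) (Z : H.Cat) (f : Z ⟶ ⟨X, hX⟩) (_ : Mono f),
      Subobject.mk f = W → H.Filtered Z.obj := by
    intro W
    induction W using WellFoundedLT.induction with
    | _ W ih =>
      rintro Z f _ rfl
      by_cases hZ : IsZero Z
      · exact Filtered.zero _ (isZero_cat_iff.1 hZ)
      · obtain ⟨V, i, _, S, hS, hVS, hi⟩ := exists_simple_quotient hZ
        exact Filtered.ext _ _ S hVS
          (ih _ (Subobject.mk_lt_mk_of_comm i rfl hi) V (i ≫ f) inferInstance rfl) hS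
  exact key _ ⟨X, hX⟩ (𝟙 _) inferInstance rfl

end BoundedHeart

end SimpleObjects

/-! ### Jordan–Hölder multiplicities -/

section Multiplicities

variable {D : Type u} [Category.{v} D] [Preadditive D] [HasZeroObject D] [HasShift D ℤ]
  [∀ n : ℤ, (shiftFunctor D n).Additive] [Pretriangulated D]

namespace BoundedHeart

variable {H : BoundedHeart D}

theorem Filtered.of_iso {X Y : D} (h : H.Filtered X) (e : X ≅ Y) : H.Filtered Y := by
  cases h with
  | zero _ hX => exact .zero _ (hX.of_iso e.symm)
  | ext A _ S h hA hS => exact .ext A Y S (h.of_iso (Iso.refl _) e (Iso.refl _)) hA hS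

theorem IsSimpleObj.filtered {S : D} (hS : H.IsSimpleObj S) : H.Filtered S :=
  .ext _ _ _ (IsExt.zero_left S (isZero_zero D)) (.zero _ (isZero_zero D)) hS

variable (H) in
/-- For a class `P` of simple objects, `MultiplicityGE P X n` says that some filtration of `X` in
the heart has at least `n` factors in `P`. -/
inductive MultiplicityGE (P : D → Prop) : D → ℕ → Prop
  | zero (X : D) : H.obj X → MultiplicityGE P X 0
  | single (S : D) : P S → MultiplicityGE P S 1
  | ext (A X B : D) (m n : ℕ) : H.obj A → H.obj B → IsExt A X B → MultiplicityGE P A m →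
      MultiplicityGE P B n → MultiplicityGE P X (m + n)

variable (H) in
/-- A class of simple objects of the heart that is closed under isomorphisms. -/
structure IsSimpleClass (P : D → Prop) : Prop where
  isSimpleObj : ∀ {S : D}, P S → H.IsSimpleObj S
  of_iso : ∀ {S S' : D}, (S ≅ S') → P S → P S'

namespace MultiplicityGE

variable {P : D → Prop}

theorem eq_zero_of_isZero (hP : H.IsSimpleClass P) {X : D} {n : ℕ} (h : H.MultiplicityGE P X n)
    (hX : IsZero X) : n = 0 := by
  induction h with
  | zero => rfl
  | single S hS => exact absurd hX (hP.isSimpleObj hS).not_isZero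
  | ext A X B m n hA hB h _ _ ihA ihB =>
    have := isZero_left_right h hA hB hX
    rw [ihA this.1, ihB this.2]

/-- A simple object contributes at most one factor, and none outside of `P`. -/
theorem of_isSimpleObj (hP : H.IsSimpleClass P) {X : D} {n : ℕ} (h : H.MultiplicityGE P X n)
    (hX : H.IsSimpleObj X) : n ≤ 1 ∧ (¬ P X → n = 0) := by
  induction h with
  | zero => exact ⟨Nat.zero_le _, fun _ => rfl⟩
  | single S hS => exact ⟨le_rfl, fun h => absurd hS h⟩
  | ext A X B m n hA hB h hm hn ihA ihB =>
    rcases hX.isZero_or hA hB h with h0 | h0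
    · obtain ⟨e⟩ := h.iso_of_isZero_left h0
      rw [hm.eq_zero_of_isZero hP h0, zero_add]
      exact ⟨(ihB (hX.of_iso e)).1, fun hX' => (ihB (hX.of_iso e)).2 fun h =>
        hX' (hP.of_iso e.symm h)⟩
    · obtain ⟨e⟩ := h.iso_of_isZero_right h0
      rw [hn.eq_zero_of_isZero hP h0, add_zero]
      exact ⟨(ihA (hX.of_iso e.symm)).1, fun hX' => (ihA (hX.of_iso e.symm)).2 fun h =>
        hX' (hP.of_iso e h)⟩

variable [IsTriangulated D]

/-- The refinement argument of the Jordan–Hölder theorem: a filtration of `X` induces filtrations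
of a subobject and of its quotient that together have the same factors. -/
theorem exists_split (hP : H.IsSimpleClass P) {X : D} {n : ℕ} (h : H.MultiplicityGE P X n) :
    ∀ {A B : D}, H.obj A → H.obj B → IsExt A X B →
      ∃ a b, H.MultiplicityGE P A a ∧ H.MultiplicityGE P B b ∧ n = a + b := by
  induction h with
  | zero X hX => exact fun hA hB _ => ⟨0, 0, .zero _ hA, .zero _ hB, rfl⟩
  | single S hS =>
    intro A B hA hB h
    rcases (hP.isSimpleObj hS).isZero_or hA hB h with h0 | h0
    · obtain ⟨e⟩ := h.iso_of_isZero_left h0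
      exact ⟨0, 1, .zero _ hA, .single _ (hP.of_iso e hS), rfl⟩
    · obtain ⟨e⟩ := h.iso_of_isZero_right h0
      exact ⟨1, 0, .single _ (hP.of_iso e.symm hS), .zero _ hB, rfl⟩
  | ext A' X B' m n hA' hB' h' _ _ ihA ihB =>
    intro A B hA hB h
    obtain ⟨R, U, V, W, hR, hU, hV, hW, h1, h2, h3, h4⟩ :=
      exists_refinement hA hB hA' hB' h h'
    obtain ⟨a₁, a₂, ha₁, ha₂, rfl⟩ := ihA hR hU h3
    obtain ⟨b₁, b₂, hb₁, hb₂, rfl⟩ := ihB hV hW h2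
    exact ⟨a₁ + b₁, a₂ + b₂, .ext R A V _ _ hR hV h1 ha₁ hb₁, .ext U B W _ _ hU hW h4 ha₂ hb₂,
      by lia⟩

theorem bddAbove (hP : H.IsSimpleClass P) {X : D} (hX : H.Filtered X) :
    BddAbove {n | H.MultiplicityGE P X n} := by
  induction hX with
  | zero X hX => exact ⟨0, fun n hn => (hn.eq_zero_of_isZero hP hX).le⟩
  | ext A X S h hA hS ih =>
    obtain ⟨N, hN⟩ := ih
    refine ⟨N + 1, fun n hn => ?_⟩
    obtain ⟨a, b, ha, hb, rfl⟩ := hn.exists_split hP hA.obj hS.obj h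
    exact add_le_add (hN ha) (hb.of_isSimpleObj hP hS).1

end MultiplicityGE

variable (H) in
/-- The number of composition factors of `X` that belong to `P`. -/
noncomputable def multiplicity (P : D → Prop) (X : D) : ℕ := sSup {n | H.MultiplicityGE P X n}

variable {P : D → Prop}

theorem multiplicityGE_multiplicity [IsTriangulated D] (hP : H.IsSimpleClass P) {X : D}
    (hX : H.Filtered X) :
    H.MultiplicityGE P X (H.multiplicity P X) :=
  Nat.sSup_mem ⟨0, .zero _ hX.obj⟩ (MultiplicityGE.bddAbove hP hX)

theorem le_multiplicity [IsTriangulated D] (hP : H.IsSimpleClass P) {X : D} (hX : H.Filtered X)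
    {n : ℕ} (hn : H.MultiplicityGE P X n) : n ≤ H.multiplicity P X :=
  le_csSup (MultiplicityGE.bddAbove hP hX) hn

theorem isAdditive_multiplicity [IsTriangulated D] (hH : H.IsLength) (hP : H.IsSimpleClass P) :
    H.IsAdditive fun X => (H.multiplicity P X : ℤ) where
  ext {A X B} hA hB h := by
    have hX := hH X (obj_mid h hA hB)
    obtain ⟨a, b, ha, hb, hab⟩ :=
      (multiplicityGE_multiplicity hP hX).exists_split hP hA hB h
    have h1 := le_multiplicity hP (hH A hA) ha
    have h2 := le_multiplicity hP (hH B hB) hb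
    have h3 := le_multiplicity hP hX (.ext A X B _ _ hA hB h
      (multiplicityGE_multiplicity hP (hH A hA)) (multiplicityGE_multiplicity hP (hH B hB)))
    lia

/-- The functional on `K(D)` that counts the composition factors belonging to `P`. -/
theorem exists_multiplicity_functional [IsTriangulated D] (hH : H.IsLength)
    (hP : H.IsSimpleClass P) :
    ∃ m : TriangulatedK D →+ ℤ, (∀ X, H.obj X → 0 ≤ m (TriangulatedK.cls X)) ∧
      (∀ S, P S → m (TriangulatedK.cls S) = 1) ∧
      (∀ S, H.IsSimpleObj S → ¬ P S → m (TriangulatedK.cls S) = 0) := by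
  obtain ⟨m, hm⟩ := (isAdditive_multiplicity hH hP).exists_extension
  refine ⟨m, fun X hX => ?_, fun S hS => ?_, fun S hS hPS => ?_⟩
  · rw [hm X hX]
    exact Int.natCast_nonneg _
  · have hS' := hP.isSimpleObj hS
    have h1 := ((multiplicityGE_multiplicity hP hS'.filtered).of_isSimpleObj hP hS').1
    have h2 := le_multiplicity hP hS'.filtered (.single _ hS)
    rw [hm S hS'.obj]
    lia
  · rw [hm S hS.obj,
      ((multiplicityGE_multiplicity hP hS.filtered).of_isSimpleObj hP hS).2 hPS, Nat.cast_zero]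

/-! ### Positive functionals and algebraic hearts -/

variable (H) in
/-- A functional that is positive on the classes of all nonzero objects of the heart. -/
def IsPositive (m : TriangulatedK D →+ ℤ) : Prop :=
  ∀ X, H.obj X → ¬ IsZero X → 0 < m (TriangulatedK.cls X)

theorem IsLength.exists_isPositive [IsTriangulated D] (hH : H.IsLength) : ∃ m, H.IsPositive m := by
  obtain ⟨m, hm, hm1, -⟩ := exists_multiplicity_functional hH
    (P := H.IsSimpleObj) ⟨id, fun e h => h.of_iso e⟩
  refine ⟨m, fun X hX hX0 => ?_⟩
  cases hH X hX with
  | zero _ h => exact absurd h hX0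
  | ext A _ S h hA hS =>
    rw [TriangulatedK.cls_ext h, map_add, hm1 S hS]
    have := hm A hA.obj
    lia

theorem Filtered.mid [IsTriangulated D] {A X B : D} (hA : H.Filtered A) (hB : H.Filtered B)
    (h : IsExt A X B) : H.Filtered X := by
  induction hB generalizing X with
  | zero B hB =>
    obtain ⟨e⟩ := h.iso_of_isZero_right hB
    exact hA.of_iso e
  | ext B' B S h' _ hS ih =>
    obtain ⟨Y, h1, h2⟩ := h.assoc h'
    exact .ext _ _ _ h2 (ih h1) hS

namespace IsPositive

variable {m : TriangulatedK D →+ ℤ}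

theorem nonneg (hm : H.IsPositive m) {X : D} (hX : H.obj X) : 0 ≤ m (TriangulatedK.cls X) := by
  by_cases h0 : IsZero X
  · rw [TriangulatedK.cls_isZero h0, map_zero]
  · exact (hm X hX h0).le

/-- Induction along a positive functional: it suffices to treat an object under the assumption
that all objects of smaller value are settled. -/
theorem induction (hm : H.IsPositive m) {C : D → Prop}
    (step : ∀ X, H.obj X → (∀ Y, H.obj Y → m (TriangulatedK.cls Y) < m (TriangulatedK.cls X) →
      C Y) → C X) (X : D) (hX : H.obj X) : C X := by
  obtain ⟨n, hn⟩ : ∃ n : ℕ, (n : ℤ) = m (TriangulatedK.cls X) :=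
    Int.eq_ofNat_of_zero_le (hm.nonneg hX) |>.imp fun _ h => h.symm
  induction n using Nat.strong_induction_on generalizing X with
  | _ n ih =>
    refine step X hX fun Y hY hYX => ?_
    obtain ⟨k, hk⟩ := Int.eq_ofNat_of_zero_le (hm.nonneg hY)
    exact ih k (by lia) Y hY hk.symm

theorem isLength [IsTriangulated D] (hm : H.IsPositive m) : H.IsLength := by
  refine hm.induction fun X hX ih => ?_
  by_cases h0 : IsZero X
  · exact .zero _ h0
  by_cases hS : H.IsSimpleObj X
  · exact hS.filtered
  obtain ⟨A, B, hA, hB, h, hA0, hB0⟩ : ∃ A B, H.obj A ∧ H.obj B ∧ IsExt A X B ∧ ¬ IsZero A ∧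
      ¬ IsZero B := by
    by_contra! hc
    exact hS ⟨hX, h0, fun {A B} hA hB h => or_iff_not_imp_left.2 (hc A B hA hB h)⟩
  have hAB := TriangulatedK.cls_ext h
  have hA' := hm A hA hA0
  have hB' := hm B hB hB0
  exact (ih A hA (by rw [hAB, map_add]; lia)).mid (ih B hB (by rw [hAB, map_add]; lia)) h

theorem lt_of_mono (hm : H.IsPositive m) {Y Z : H.Cat} (i : Y ⟶ Z) [Mono i] (hi : ¬ IsIso i) :
    m (TriangulatedK.cls Y.obj) < m (TriangulatedK.cls Z.obj) := by
  obtain ⟨B, g, k, hT, hB⟩ := exists_cone_of_mono i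
  have h0 : ¬ IsZero B := fun h => hi ((isIso_iff_isZero_cone i hT).2 h)
  rw [TriangulatedK.cls_ext ⟨_, _, _, hT⟩, map_add]
  have := hm B hB h0
  lia

theorem le_of_mono (hm : H.IsPositive m) {Y Z : H.Cat} (i : Y ⟶ Z) [Mono i] :
    m (TriangulatedK.cls Y.obj) ≤ m (TriangulatedK.cls Z.obj) := by
  obtain ⟨B, g, k, hT, hB⟩ := exists_cone_of_mono i
  rw [TriangulatedK.cls_ext ⟨_, _, _, hT⟩, map_add]
  have := hm.nonneg hB
  lia

theorem lt_of_lt (hm : H.IsPositive m) {X : H.Cat} {Y Z : Subobject X} (h : Y < Z) :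
    m (TriangulatedK.cls (Y : H.Cat).obj) < m (TriangulatedK.cls (Z : H.Cat).obj) := by
  refine hm.lt_of_mono (Subobject.ofLE Y Z h.le) fun hi => h.ne ?_
  exact Subobject.eq_of_comm (asIso (Subobject.ofLE Y Z h.le)) (by simp)

/-- The value of a positive functional bounds the length of chains of subobjects. -/
theorem isNoetherianObject (hm : H.IsPositive m) (X : H.Cat) : IsNoetherianObject X := by
  rw [isNoetherianObject_iff_not_strictMono]
  intro f hf
  have h1 : ∀ n : ℕ, (n : ℤ) ≤ m (TriangulatedK.cls (f n : H.Cat).obj) := by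
    intro n
    induction n with
    | zero => exact hm.nonneg (f 0 : H.Cat).property
    | succ n ih =>
      have := hm.lt_of_lt (hf (Nat.lt_succ_self n))
      push_cast
      lia
  have h2 := h1 ((m (TriangulatedK.cls X.obj)).toNat + 1)
  have h3 := hm.le_of_mono (f ((m (TriangulatedK.cls X.obj)).toNat + 1)).arrow
  lia

theorem isArtinianObject (hm : H.IsPositive m) (X : H.Cat) : IsArtinianObject X := by
  rw [isArtinianObject_iff_not_strictAnti]
  intro f hf
  have h1 : ∀ n : ℕ, m (TriangulatedK.cls (f n : H.Cat).obj) ≤ m (TriangulatedK.cls X.obj) - n := by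
    intro n
    induction n with
    | zero => simpa using hm.le_of_mono (f 0).arrow
    | succ n ih =>
      have := hm.lt_of_lt (hf (Nat.lt_succ_self n))
      push_cast
      lia
  have h2 := h1 ((m (TriangulatedK.cls X.obj)).toNat + 1)
  have h3 := hm.nonneg (f ((m (TriangulatedK.cls X.obj)).toNat + 1) : H.Cat).property
  lia

end IsPositive

/-- The classes of pairwise non-isomorphic simple objects of a length heart are linearly
independent, the multiplicities being dual functionals. -/
theorem IsLength.finite_simples [IsTriangulated D] [Module.Finite ℤ (TriangulatedK D)]
    (hH : H.IsLength) : {c : Quotient (isIsomorphicSetoid H.Cat) |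
      ∃ S : H.Cat, Simple S ∧ Quotient.mk _ S = c}.Finite := by
  let ι := {c : Quotient (isIsomorphicSetoid H.Cat) // ∃ S : H.Cat, Simple S ∧ Quotient.mk _ S = c}
  choose S hS hSc using fun c : ι => c.2
  have hS' : ∀ c, H.IsSimpleObj (S c).obj := fun c => simple_iff_isSimpleObj.1 (hS c)
  choose m _ hm1 hm0 using fun c : ι => exists_multiplicity_functional hH
    (P := fun X => Nonempty ((S c).obj ≅ X))
    ⟨fun ⟨e⟩ => (hS' c).of_iso e, fun e ⟨e'⟩ => ⟨e' ≪≫ e⟩⟩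
  have hli : LinearIndependent ℤ fun c : ι => TriangulatedK.cls (S c).obj := by
    rw [linearIndependent_iff']
    intro s g hg i hi
    have h := congrArg (m i) hg
    rw [map_sum, map_zero, Finset.sum_eq_single i, map_zsmul, hm1 i _ ⟨Iso.refl _⟩] at h
    · simpa using h
    · intro j _ hj
      rw [map_zsmul, hm0 i _ (hS' j), smul_zero]
      rintro ⟨e⟩
      refine hj (Subtype.ext ?_)
      rw [← hSc j, ← hSc i]
      exact Quotient.sound ⟨H.obj.isoMk e.symm⟩
    · exact fun h => absurd hi h
  have : Finite ι := hli.finite_of_isNoetherian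
  exact Set.finite_coe_iff.1 this

theorem IsPositive.isAlgebraic [IsTriangulated D] [Module.Finite ℤ (TriangulatedK D)]
    {m : TriangulatedK D →+ ℤ} (hm : H.IsPositive m) : H.IsAlgebraic where
  noetherian := hm.isNoetherianObject
  artinian := hm.isArtinianObject
  finite_simples := hm.isLength.finite_simples

theorem IsAlgebraic.exists_finite_simples (hH : H.IsAlgebraic) :
    ∃ s : Set D, s.Finite ∧ (∀ S ∈ s, H.IsSimpleObj S) ∧
      ∀ S, H.IsSimpleObj S → ∃ S' ∈ s, Nonempty (S' ≅ S) := by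
  refine ⟨(fun c => (Quotient.out c : H.Cat).obj) '' _, hH.finite_simples.image _, ?_, ?_⟩
  · rintro _ ⟨_, ⟨S, hS, rfl⟩, rfl⟩
    obtain ⟨e⟩ := Quotient.mk_out (s := isIsomorphicSetoid H.Cat) S
    exact (simple_iff_isSimpleObj.1 hS).of_iso (H.obj.ι.mapIso e.symm)
  · intro S hS
    refine ⟨_, ⟨_, ⟨⟨S, hS.obj⟩, simple_iff_isSimpleObj.2 hS, rfl⟩, rfl⟩, ?_⟩
    obtain ⟨e⟩ := Quotient.mk_out (s := isIsomorphicSetoid H.Cat) (⟨S, hS.obj⟩ : H.Cat)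
    exact ⟨H.obj.ι.mapIso e⟩

theorem _root_.TriangulatedK.cls_mem_of_shift_mem {N : AddSubgroup (TriangulatedK D)} {X : D}
    (n : ℤ) (h : TriangulatedK.cls (X⟦n⟧) ∈ N) : TriangulatedK.cls X ∈ N := by
  induction n using Int.induction_on with
  | zero => rwa [TriangulatedK.cls_iso ((shiftFunctorZero D ℤ).app X)] at h
  | succ i ih =>
    rw [TriangulatedK.cls_iso ((shiftFunctorAdd' D (i : ℤ) 1 (i + 1) rfl).app X)] at h
    refine ih ?_
    have h' := TriangulatedK.cls_shift_one (X⟦(i : ℤ)⟧)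
    exact neg_mem_iff.1 (h' ▸ h)
  | pred i ih =>
    refine ih ?_
    rw [TriangulatedK.cls_iso ((shiftFunctorAdd' D (-(i : ℤ) - 1) 1 (-i) (by lia)).app X)]
    have h' := TriangulatedK.cls_shift_one (X⟦(-(i : ℤ) - 1)⟧)
    exact h'.symm ▸ neg_mem h

/-- The classes of the simple objects of a length heart generate `K(D)`. -/
theorem IsAlgebraic.module_finite [IsTriangulated D] (hH : H.IsAlgebraic) :
    Module.Finite ℤ (TriangulatedK D) := by
  obtain ⟨s, hs, -, hsS⟩ := hH.exists_finite_simples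
  obtain ⟨N, hN⟩ : ∃ N : AddSubgroup (TriangulatedK D),
      N = AddSubgroup.closure (TriangulatedK.cls '' s) := ⟨_, rfl⟩
  have h1 : ∀ X, H.Filtered X → TriangulatedK.cls X ∈ N := by
    intro X hX
    induction hX with
    | zero X hX => rw [TriangulatedK.cls_isZero hX]; exact zero_mem N
    | ext A X S h _ hS ih =>
      obtain ⟨S', hS', ⟨e⟩⟩ := hsS S hS
      rw [TriangulatedK.cls_ext h, ← TriangulatedK.cls_iso e]
      exact add_mem ih (hN ▸ AddSubgroup.subset_closure ⟨S', hS', rfl⟩)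
  have h2 : ∀ X : D, TriangulatedK.cls X ∈ N := by
    refine amplitude_induction (H := H) (fun X hX => ?_) (fun A X Q b h _ hQ hQ' ih => ?_)
    · rw [TriangulatedK.cls_isZero hX]; exact zero_mem N
    · rw [TriangulatedK.cls_ext h]
      exact add_mem ih (TriangulatedK.cls_mem_of_shift_mem b (h1 _ (hH.isLength _
        ⟨(aisle_shift_iff b b 0 (by lia)).2 hQ, (coaisle_shift_iff b b 0 (by lia)).2 hQ'⟩)))
  have h3 : N = ⊤ := by
    rw [eq_top_iff]
    rintro x -
    obtain ⟨y, rfl⟩ := QuotientAddGroup.mk_surjective x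
    induction y using FreeAbelianGroup.induction_on with
    | zero => exact zero_mem N
    | of X => exact h2 X
    | neg X _ => exact neg_mem (h2 X)
    | add a b ha hb => exact add_mem ha hb
  rw [Module.Finite.iff_addGroup_fg]
  exact ⟨⟨(hs.image _).toFinset, by rw [Set.Finite.coe_toFinset, ← hN, h3]⟩⟩

end BoundedHeart

end Multiplicities

/-! ### Tilting at a torsion-free class -/

section Tilting

variable {D : Type u} [Category.{v} D] [Preadditive D] [HasZeroObject D] [HasShift D ℤ]
  [∀ n : ℤ, (shiftFunctor D n).Additive] [Pretriangulated D]

namespace BoundedHeart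

variable {H : BoundedHeart D}

variable (H) in
/-- A class of objects of the heart that is closed under subobjects and extensions. In a length
category these are the torsion-free classes of torsion pairs. -/
structure IsTorsionFreeClass (F : ObjectProperty D) : Prop where
  obj : ∀ {X : D}, F X → H.obj X
  zero : ∀ {X : D}, IsZero X → F X
  sub : ∀ {A X B : D}, H.obj A → H.obj B → IsExt A X B → F X → F A
  ext : ∀ {A X B : D}, IsExt A X B → F A → F B → F X

variable {F : ObjectProperty D}

theorem IsTorsionFreeClass.of_iso (hF : H.IsTorsionFreeClass F) {X Y : D} (e : X ≅ Y) (hX : F X) :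
    F Y :=
  hF.sub (obj_of_iso e (hF.obj hX)) (obj_of_isZero (isZero_zero D))
    ((IsExt.zero_right Y (isZero_zero D)).of_iso (Iso.refl _) e.symm (Iso.refl _)) hX

variable (H F) in
/-- The aisle of the tilt of `H` at the torsion-free class `F`. -/
def tiltAisle (X : D) : Prop := H.aisle 0 X ∧ ∀ Y, F Y → ∀ f : X ⟶ Y, f = 0

variable (H F) in
/-- The co-aisle of the tilt of `H` at the torsion-free class `F`. -/
def tiltCoaisle (X : D) : Prop := ∃ f g, F f ∧ H.coaisle 1 g ∧ IsExt f X g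

theorem tiltAisle_of_iso {X Y : D} (e : X ≅ Y) (h : H.tiltAisle F X) : H.tiltAisle F Y :=
  ⟨aisle_of_iso e h.1, fun Z hZ f => by
    rw [← cancel_epi e.hom, h.2 Z hZ (e.hom ≫ f), comp_zero]⟩

theorem tiltCoaisle_of_iso {X Y : D} (e : X ≅ Y) (h : H.tiltCoaisle F X) : H.tiltCoaisle F Y := by
  obtain ⟨f, g, hf, hg, h⟩ := h
  exact ⟨f, g, hf, hg, h.of_iso (Iso.refl _) e (Iso.refl _)⟩

theorem tiltAisle_of_aisle (hF : H.IsTorsionFreeClass F) {X : D} (hX : H.aisle (-1) X) :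
    H.tiltAisle F X :=
  ⟨aisle_mono (by lia) hX, fun _ hY f => hom_eq_zero (by lia) hX (hF.obj hY).2 f⟩

theorem tiltCoaisle_of_coaisle (hF : H.IsTorsionFreeClass F) {X : D} (hX : H.coaisle 1 X) :
    H.tiltCoaisle F X :=
  ⟨_, X, hF.zero (isZero_zero D), hX, IsExt.zero_left X (isZero_zero D)⟩

theorem coaisle_of_tiltCoaisle (hF : H.IsTorsionFreeClass F) {X : D} (hX : H.tiltCoaisle F X) :
    H.coaisle 0 X := by
  obtain ⟨f, g, hf, hg, h⟩ := hX
  exact coaisle_mid h (hF.obj hf).2 (coaisle_anti (by lia) hg)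

section

variable [IsTriangulated D] {m : TriangulatedK D →+ ℤ}

/-- Every object of the heart is an extension of an object of `F` by an object without nonzero
morphisms to `F`. A morphism to an object of `F` is replaced by the kernel until it is zero; the
value of the positive functional bounds the number of steps. -/
theorem IsTorsionFreeClass.exists_torsion_pair (hF : H.IsTorsionFreeClass F)
    (hm : H.IsPositive m) : ∀ X : D, H.obj X →
    ∃ t f, IsExt t X f ∧ H.obj t ∧ (∀ Y, F Y → ∀ f : t ⟶ Y, f = 0) ∧ F f := by
  refine hm.induction fun X hX ih => ?_
  by_cases h0 : ∀ Y, F Y → ∀ f : X ⟶ Y, f = 0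
  · exact ⟨X, _, IsExt.zero_right X (isZero_zero D), hX, h0, hF.zero (isZero_zero D)⟩
  push Not at h0
  obtain ⟨Y, hY, f, hf⟩ := h0
  obtain ⟨K, I, Q, hK, hI, hQ, h1, h2, h3⟩ := exists_image hX (hF.obj hY) f
  have hI0 := hm I hI fun h => hf (h3 h)
  obtain ⟨t, f', h, ht, ht0, hf'⟩ := ih K hK (by rw [TriangulatedK.cls_ext h1, map_add]; lia)
  obtain ⟨W, hW1, hW2⟩ := h1.assoc' h
  exact ⟨t, W, hW1, ht, ht0, hF.ext hW2 hf' (hF.sub hI hQ h2 hY)⟩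

/-- The tilt (after Happel, Reiten and Smalø) of a heart with a positive functional at a
torsion-free class. -/
def tilt (hF : H.IsTorsionFreeClass F) (hm : H.IsPositive m) : BoundedHeart D where
  tStructure :=
    { le := fun n X => H.tiltAisle F (X⟦n⟧)
      ge := fun n X => H.tiltCoaisle F (X⟦n - 1⟧)
      le_isClosedUnderIsomorphisms := fun n =>
        ⟨fun e h => tiltAisle_of_iso ((shiftFunctor D n).mapIso e) h⟩
      ge_isClosedUnderIsomorphisms := fun n =>
        ⟨fun e h => tiltCoaisle_of_iso ((shiftFunctor D (n - 1)).mapIso e) h⟩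
      le_shift := fun n a n' h X hX =>
        tiltAisle_of_iso ((shiftFunctorAdd' D a n' n h).app X) hX
      ge_shift := fun n a n' h X hX =>
        tiltCoaisle_of_iso ((shiftFunctorAdd' D a (n' - 1) (n - 1) (by lia)).app X) hX
      zero' := fun X Y φ hX hY => by
        replace hX := tiltAisle_of_iso ((shiftFunctorZero D ℤ).app X) hX
        obtain ⟨f, g, hf, hg, h⟩ :=
          tiltCoaisle_of_iso ((shiftFunctorZero' D (1 - 1 : ℤ) (by lia)).app Y) hY
        exact h.hom_to_mid_eq_zero (hX.2 f hf) (hom_eq_zero (by lia) hX.1 hg) φ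
      le_zero_le := fun X hX => by
        have hX' := (tiltAisle_of_iso ((shiftFunctorZero D ℤ).app X) hX).1
        exact tiltAisle_of_aisle hF ((aisle_shift_iff 0 1 (-1) (by lia)).2 hX')
      ge_one_le := fun X hX => by
        have hX' := coaisle_of_tiltCoaisle hF
          (tiltCoaisle_of_iso ((shiftFunctorZero' D (1 - 1 : ℤ) (by lia)).app X) hX)
        exact tiltCoaisle_of_coaisle hF ((coaisle_shift_iff 0 (0 - 1) 1 (by lia)).2 hX')
      exists_triangle_zero_one := fun A => by
        obtain ⟨P, Q, h, hP, hQ⟩ := H.exists_truncation A 0 1 (by lia)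
        obtain ⟨R, S, h', hR, hS⟩ := H.exists_truncation P (-1) 0 (by lia)
        obtain ⟨t, f, h'', ht, ht0, hf⟩ := hF.exists_torsion_pair hm S
          ⟨aisle_right h' (aisle_mono (by lia) hR) hP, hS⟩
        obtain ⟨X, hX1, hX2⟩ := h'.assoc h''
        obtain ⟨Y, hY1, hY2⟩ := h.assoc' hX2
        obtain ⟨a, b, c, hT⟩ := hY1
        have hX : H.tiltAisle F X := ⟨aisle_mid hX1 (aisle_mono (by lia) hR) ht.1, fun Z hZ =>
          hX1.hom_from_mid_eq_zero (hom_eq_zero (by lia) hR (hF.obj hZ).2) (ht0 Z hZ)⟩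
        exact ⟨X, Y, tiltAisle_of_iso ((shiftFunctorZero D ℤ).app X).symm hX,
          tiltCoaisle_of_iso ((shiftFunctorZero' D (1 - 1 : ℤ) (by lia)).app Y).symm
            ⟨f, Q, hf, hQ, hY2⟩, a, b, c, hT⟩ }
  bounded := fun X => by
    obtain ⟨p, q, hp, hq⟩ := H.exists_bounds X
    exact ⟨⟨p, ⟨tiltCoaisle_of_coaisle hF ((coaisle_shift_iff p (p - 1) 1 (by lia)).2 hp)⟩⟩,
      ⟨q + 1, ⟨tiltAisle_of_aisle hF ((aisle_shift_iff q (q + 1) (-1) (by lia)).2 hq)⟩⟩⟩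

theorem tilt_coaisle_one_iff (hF : H.IsTorsionFreeClass F) (hm : H.IsPositive m) {X : D} :
    (tilt hF hm).coaisle 1 X ↔ H.tiltCoaisle F X :=
  ⟨tiltCoaisle_of_iso ((shiftFunctorZero' D (1 - 1 : ℤ) (by lia)).app X),
    tiltCoaisle_of_iso ((shiftFunctorZero' D (1 - 1 : ℤ) (by lia)).app X).symm⟩

theorem le_tilt (hF : H.IsTorsionFreeClass F) (hm : H.IsPositive m) : H ≤ tilt hF hm :=
  fun _ hX => (tilt_coaisle_one_iff hF hm).2 (tiltCoaisle_of_coaisle hF hX)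

theorem tilt_le_shift (hF : H.IsTorsionFreeClass F) (hm : H.IsPositive m) :
    tilt hF hm ≤ H.shift :=
  fun _ hX => coaisle_anti (H := H) (m := 1 - 1) (n := 0) (by lia)
    (coaisle_of_tiltCoaisle hF ((tilt_coaisle_one_iff hF hm).1 hX))

theorem free_tilt (hF : H.IsTorsionFreeClass F) (hm : H.IsPositive m) :
    H.free (tilt hF hm) = F := by
  ext X
  constructor
  · rintro ⟨hX, hX'⟩
    obtain ⟨f, g, hf, hg, h⟩ := (tilt_coaisle_one_iff hF hm).1 hX'
    have hg0 := isZero_of_aisle_of_coaisle (by lia)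
      (aisle_right h (aisle_mono (by lia) (hF.obj hf).1) hX.1) hg
    obtain ⟨e⟩ := h.iso_of_isZero_right hg0
    exact hF.of_iso e hf
  · intro hX
    exact ⟨hF.obj hX, (tilt_coaisle_one_iff hF hm).2 ⟨X, _, hX, coaisle_of_isZero (isZero_zero D) 1,
      IsExt.zero_right X (isZero_zero D)⟩⟩

end

end BoundedHeart

end Tilting

/-! ### Hearts defined by stability functionals -/

section Stability

variable {D : Type u} [Category.{v} D] [Preadditive D] [HasZeroObject D] [HasShift D ℤ]
  [∀ n : ℤ, (shiftFunctor D n).Additive] [Pretriangulated D]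

open TriangulatedK (cls cls_ext cls_iso cls_isZero cls_shift_one)

namespace BoundedHeart

variable {H K L : BoundedHeart D}

/-- An integral functional, as a point of the real vector space that contains the heart cones. -/
def realFunctional (m : TriangulatedK D →+ ℤ) : TriangulatedK D →+ ℝ :=
  (Int.castAddHom ℝ).comp m

theorem realFunctional_mem_heartCone {m : TriangulatedK D →+ ℤ} :
    realFunctional m ∈ K.heartCone ↔ ∀ X, K.obj X → 0 ≤ m (cls X) :=
  forall₂_congr fun _ _ => Int.cast_nonneg_iff

theorem nonneg_of_torsion (hHK : H ≤ K) {m : TriangulatedK D →+ ℤ}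
    (hm : realFunctional m ∈ K.heartCone) {X : D} (hX : H.torsion K X) : 0 ≤ m (cls X) :=
  realFunctional_mem_heartCone.1 hm X (obj_of_torsion hHK hX)

theorem nonpos_of_free (hKH : K ≤ H.shift) {m : TriangulatedK D →+ ℤ}
    (hm : realFunctional m ∈ K.heartCone) {X : D} (hX : H.free K X) : m (cls X) ≤ 0 := by
  have := realFunctional_mem_heartCone.1 hm _ (obj_shift_of_free hKH hX)
  rw [cls_shift_one, map_neg] at this
  lia

variable (H) in
/-- The objects of the heart all of whose nonzero subobjects have negative value under `m`. -/
def negative (m : TriangulatedK D →+ ℤ) : ObjectProperty D := fun X =>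
  H.obj X ∧ ∀ A B, H.obj A → H.obj B → IsExt A X B → ¬ IsZero A → m (cls A) < 0

/-- An extension of `m`-negative objects is `m`-negative, as a subobject of the middle term is an
extension of subobjects of the outer terms. -/
theorem isTorsionFreeClass_negative [IsTriangulated D] (m : TriangulatedK D →+ ℤ) :
    H.IsTorsionFreeClass (H.negative m) where
  obj h := h.1
  zero hX := ⟨obj_of_isZero hX, fun A B hA hB h hA0 => absurd (isZero_left_right h hA hB hX).1 hA0⟩
  sub hA hB h hX := ⟨hA, fun A' B' hA' hB' h' hA0 => by
    obtain ⟨Y, hY, h1, -⟩ := exists_sub_sub h h' hB hB'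
    exact hX.2 A' Y hA' hY h1 hA0⟩
  ext {A X B} h hA hB := ⟨obj_mid h hA.1 hB.1, fun A' B' hA' hB' h' hA0 => by
    obtain ⟨P, U, V, W, hP, hU, hV, hW, h1, h2, h3, h4⟩ :=
      exists_refinement hA' hB' hA.1 hB.1 h' h
    have hPneg := hA.2 P U hP hU h3
    have hVneg := hB.2 V W hV hW h2
    rw [cls_ext h1, map_add]
    by_cases hP0 : IsZero P
    · have hV0 : ¬ IsZero V := fun hV0 => hA0 (h1.isZero_mid hP0 hV0)
      rw [cls_isZero hP0, map_zero, zero_add]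
      exact hVneg hV0
    · by_cases hV0 : IsZero V
      · rw [cls_isZero hV0, map_zero, add_zero]
        exact hPneg hP0
      · exact add_neg (hPneg hP0) (hVneg hV0)⟩

/-- The functional `m` lies in the cone of the tilt at the `m`-negative objects: an object without
nonzero `m`-negative quotients has nonnegative value. In particular the heart cones of the
intermediate hearts contain all integral points. -/
theorem realFunctional_mem_heartCone_of_free_eq (hHK : H ≤ K) (hKH : K ≤ H.shift)
    {p m : TriangulatedK D →+ ℤ} (hp : H.IsPositive p) (h : H.free K = H.negative m) :
    realFunctional m ∈ K.heartCone := by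
  have hT : ∀ X, H.obj X → K.aisle 0 X → 0 ≤ m (cls X) := by
    refine hp.induction fun X hX ih hXK => ?_
    by_contra! hneg
    have hX0 : ¬ IsZero X := fun h0 => by
      rw [cls_isZero h0, map_zero] at hneg
      exact lt_irrefl _ hneg
    have hXm : ¬ H.negative m X := fun hXm => by
      rw [← h] at hXm
      exact hX0 (isZero_of_torsion_of_free ⟨hX, hXK⟩ hXm)
    obtain ⟨A, B, hA, hB, hAB, hA0, hAm⟩ : ∃ A B, H.obj A ∧ H.obj B ∧ IsExt A X B ∧ ¬ IsZero A ∧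
        0 ≤ m (cls A) := by
      by_contra! hc
      exact hXm ⟨hX, hc⟩
    have hpA := hp A hA hA0
    have hmB := ih B hB (by rw [cls_ext hAB, map_add]; lia)
      (torsion_quotient hKH hAB hA hB hXK).2
    rw [cls_ext hAB, map_add] at hneg
    lia
  refine realFunctional_mem_heartCone.2 fun X hX => ?_
  obtain ⟨f, t, hft, hf, ht⟩ := exists_ext_of_obj hHK hKH hX
  rw [cls_ext hft, cls_shift_one, map_add, map_neg]
  have h1 := hT t ht.1 ht.2
  have h2 : m (cls f) ≤ 0 := by
    by_cases h0 : IsZero f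
    · rw [cls_isZero h0, map_zero]
    · rw [h] at hf
      exact (hf.2 f _ hf.1 (obj_of_isZero (isZero_zero D)) (IsExt.zero_right f (isZero_zero D))
        h0).le
  lia

/-- Every integral functional lies in the cone of an intermediate heart. -/
theorem exists_realFunctional_mem_heartCone [IsTriangulated D] {p : TriangulatedK D →+ ℤ}
    (hp : H.IsPositive p) (m : TriangulatedK D →+ ℤ) :
    ∃ K : BoundedHeart D, H ≤ K ∧ K ≤ H.shift ∧ realFunctional m ∈ K.heartCone :=
  let K := tilt (isTorsionFreeClass_negative m) hp
  have h1 : H ≤ K := le_tilt _ hp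
  have h2 : K ≤ H.shift := tilt_le_shift _ hp
  ⟨K, h1, h2, realFunctional_mem_heartCone_of_free_eq h1 h2 hp (free_tilt _ hp)⟩

/-- A heart with a positive functional is determined by its cone among the hearts above it. -/
theorem heartCone_ne (hLK : L ≤ K) (hKL : K ≤ L.shift) (h : ¬ K ≤ L) {m : TriangulatedK D →+ ℤ}
    (hm : L.IsPositive m) : L.heartCone ≠ K.heartCone := by
  intro heq
  have hmem : realFunctional m ∈ K.heartCone :=
    heq ▸ realFunctional_mem_heartCone.2 fun X hX => hm.nonneg hX
  obtain ⟨X, hX, hX0⟩ := exists_free_of_not_le hLK hKL h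
  have h1 := hm X hX.1 hX0
  have h2 := nonpos_of_free hKL hmem hX
  lia

/-! ### Crossing a wall of the cone of an algebraic heart -/

/-- If `K` is strictly larger than the length heart `L`, then a simple object of `L` is torsion-free
for `K`. -/
theorem exists_simple_of_not_le (hLK : L ≤ K) (hKL : K ≤ L.shift) (h : ¬ K ≤ L)
    (hL : L.IsLength) : ∃ S, L.IsSimpleObj S ∧ K.coaisle 1 S := by
  obtain ⟨X, ⟨hX, hXK⟩, hX0⟩ := exists_free_of_not_le hLK hKL h
  have hXf := hL X hX
  clear hX
  induction hXf with
  | zero X h0 => exact absurd h0 hX0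
  | ext A X S h hA hS ih =>
    by_cases hA0 : IsZero A
    · obtain ⟨e⟩ := h.iso_of_isZero_left hA0
      exact ⟨S, hS, coaisle_of_iso e hXK⟩
    · exact ih hA0 (free_sub hLK h hA.obj hS.obj hXK).2

/-- For a simple object `S` of a length heart, the functional `s` counts the composition factors
isomorphic to `S`, and `w` counts the others. -/
theorem exists_wall_functionals [IsTriangulated D] (hL : L.IsLength) {S : D}
    (hS : L.IsSimpleObj S) : ∃ w s : TriangulatedK D →+ ℤ,
      (∀ X, L.obj X → 0 ≤ w (cls X)) ∧ w (cls S) = 0 ∧ s (cls S) = 1 ∧ L.IsPositive (w + s) ∧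
      ∀ X, L.obj X → ¬ IsZero X → w (cls X) = 0 → ∃ A, L.obj A ∧ IsExt A X S := by
  obtain ⟨s, hs, hs1, hs0⟩ := exists_multiplicity_functional hL
    (P := fun X => Nonempty (S ≅ X)) ⟨fun ⟨e⟩ => hS.of_iso e, fun e ⟨e'⟩ => ⟨e' ≪≫ e⟩⟩
  obtain ⟨w, hw, hw1, hw0⟩ := exists_multiplicity_functional hL
    (P := fun X => L.IsSimpleObj X ∧ ¬ Nonempty (S ≅ X))
    ⟨fun h => h.1, fun e h => ⟨h.1.of_iso e, fun ⟨e'⟩ => h.2 ⟨e' ≪≫ e.symm⟩⟩⟩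
  refine ⟨w, s, hw, hw0 S hS fun h => h.2 ⟨Iso.refl _⟩, hs1 S ⟨Iso.refl _⟩, fun X hX hX0 => ?_,
    fun X hX hX0 hwX => ?_⟩
  · cases hL X hX with
    | zero _ h0 => exact absurd h0 hX0
    | ext A _ S' h hA hS' =>
      rw [cls_ext h, map_add, AddMonoidHom.add_apply, AddMonoidHom.add_apply]
      have h1 := hw A hA.obj
      have h2 := hs A hA.obj
      by_cases hSS' : Nonempty (S ≅ S')
      · have h3 := hs1 S' hSS'
        have h4 := hw S' hS'.obj
        lia
      · have h3 := hw1 S' ⟨hS', hSS'⟩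
        have h4 := hs S' hS'.obj
        lia
  · cases hL X hX with
    | zero _ h0 => exact absurd h0 hX0
    | ext A _ S' h hA hS' =>
      by_cases hSS' : Nonempty (S ≅ S')
      · obtain ⟨e⟩ := hSS'
        exact ⟨A, hA.obj, h.of_iso (Iso.refl _) (Iso.refl _) e.symm⟩
      · rw [cls_ext h, map_add] at hwX
        have h3 := hw1 S' ⟨hS', hSS'⟩
        have h1 := hw A hA.obj
        lia

/-- Suppose that the cone of the intermediate heart `J` contains `N • w - s` for infinitely many
`N`, where `w` and `s` are the functionals of a simple object `S` of the intermediate length heart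
`L`. These points approach the wall `S = 0` of the cone of `L` from outside, and `J` is the heart on
the other side of this wall, the tilt of `L` at `S`. In particular `J` has a positive
functional. -/
theorem isPositive_of_wall_crossing [IsTriangulated D] {J : BoundedHeart D} (hHL : H ≤ L)
    (hLH : L ≤ H.shift) (hHJ : H ≤ J) (hJH : J ≤ H.shift) (hLK : L ≤ K) {S : D}
    (hS : L.IsSimpleObj S) (hSH : H.obj S) (hSK : K.coaisle 1 S) {w s : TriangulatedK D →+ ℤ}
    (hw : ∀ X, L.obj X → 0 ≤ w (cls X)) (hwS : w (cls S) = 0) (hsS : s (cls S) = 1)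
    (hws : L.IsPositive (w + s))
    (hwall : ∀ X, L.obj X → ¬ IsZero X → w (cls X) = 0 → ∃ A, L.obj A ∧ IsExt A X S)
    {I : Set ℕ} (hI : I.Infinite) (hIJ : ∀ N ∈ I, realFunctional (N • w - s) ∈ J.heartCone) :
    L ≤ J ∧ J ≤ K ∧ ¬ J ≤ L ∧ ∃ m, J.IsPositive m := by
  have happ : ∀ (N : ℕ) (X : D), (N • w - s) (cls X) = N * w (cls X) - s (cls X) := fun N X => by
    simp
  have hwT : ∀ X, H.torsion J X → 0 ≤ w (cls X) := by
    intro X hX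
    obtain ⟨N, hN, hN'⟩ := hI.exists_gt (s (cls X)).natAbs
    have h := nonneg_of_torsion hHJ (hIJ N hN) hX
    rw [happ] at h
    by_contra! hneg
    have : (N : ℤ) * w (cls X) ≤ N * (-1) :=
      mul_le_mul_of_nonneg_left (by lia) (Int.natCast_nonneg N)
    lia
  have hwF : ∀ X, H.free J X → w (cls X) ≤ 0 := by
    intro X hX
    obtain ⟨N, hN, hN'⟩ := hI.exists_gt (s (cls X)).natAbs
    have h := nonpos_of_free hJH (hIJ N hN) hX
    rw [happ] at h
    by_contra! hpos
    have : (N : ℤ) * 1 ≤ N * w (cls X) :=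
      mul_le_mul_of_nonneg_left (by lia) (Int.natCast_nonneg N)
    lia
  -- If `X` is torsion for `J` and torsion-free for `L`, then `w` vanishes on `X⟦1⟧`, an object of
  -- `L`. So if `X` is nonzero, `S` is a quotient of `X⟦1⟧` in `L`, but there is no nonzero morphism
  -- from `X⟦1⟧` to `S`, because both `X` and `S` lie in `H`.
  have hzero : ∀ X, H.torsion J X → H.free L X → IsZero X := by
    intro X hX hX'
    by_contra hX0
    have hXL := obj_shift_of_free hLH hX'
    have h1 := hw _ hXL
    have h2 := hwT X hX
    have hX10 : ¬ IsZero (X⟦(1 : ℤ)⟧) := fun h0 =>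
      hX0 ((Functor.map_isZero (shiftFunctor D (-1 : ℤ)) h0).of_iso
        ((shiftEquiv D (1 : ℤ)).unitIso.app X))
    rw [cls_shift_one, map_neg] at h1
    obtain ⟨A, hA, hAS⟩ := hwall _ hXL hX10 (by rw [cls_shift_one, map_neg]; lia)
    refine hS.not_isZero ((IsZero.iff_id_eq_zero S).2 (hAS.rot.hom_from_mid_eq_zero
      (hom_eq_zero (by lia) ((aisle_shift_iff 0 1 (-1) (by lia)).2 hX.1.1) hSH.2)
      (hom_eq_zero (by lia) ((aisle_shift_iff 0 1 (-1) (by lia)).2 hA.1) hS.obj.2) _))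
  have hLJ : L ≤ J := by
    refine le_of_free_le hHL hLH hHJ fun X hX => ?_
    obtain ⟨t, f, h, ht, hf⟩ := exists_torsion_free hHJ hJH hX.1
    obtain ⟨e⟩ := h.iso_of_isZero_left (hzero t ht (free_sub hHL h ht.1 hf.1 hX.2))
    exact free_of_iso e.symm hf
  have hJL : J ≤ L.shift := hJH.trans (shift_le_shift hHL)
  have hSJ : J.coaisle 1 S := by
    obtain ⟨u, q, h, hu, hq⟩ := exists_torsion_free hHJ hJH hSH
    obtain ⟨a, b, hab, ha, hb⟩ := exists_torsion_free hHL hLH hu.1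
    obtain ⟨y, hay, hby⟩ := h.assoc' hab
    have hy := torsion_quotient hLH hay ha.1 (obj_mid hby hb.1 hq.1) hS.obj.1
    rcases hS.isZero_or (obj_of_torsion hHL ha) (obj_of_torsion hHL hy) hay with h0 | h0
    · obtain ⟨e⟩ := hab.iso_of_isZero_left h0
      obtain ⟨e'⟩ := h.iso_of_isZero_left (hzero u hu (free_of_iso e.symm hb))
      exact coaisle_of_iso e'.symm hq.2
    · obtain ⟨e⟩ := h.iso_of_isZero_right (isZero_left_right hby hb.1 hq.1 h0).2
      obtain ⟨N, hN⟩ := hI.nonempty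
      have := nonneg_of_torsion hHJ (hIJ N hN) (torsion_of_iso e hu)
      rw [happ, hwS, hsS] at this
      lia
  -- On a common object of the torsion class of `L` and the torsion-free class of `J`, the bounds
  -- from the two sides meet.
  have hwTF : ∀ X, H.torsion L X → H.free J X → w (cls X) = 0 := fun X hX hX' =>
    le_antisymm (hwF X hX') (hw X (obj_of_torsion hHL hX))
  refine ⟨hLJ, ?_, fun h => hS.not_isZero (isZero_of_aisle_of_coaisle (by lia) hS.obj.1
    (coaisle_of_le h hSJ)), ?_⟩
  · have hwK : ∀ X, L.obj X → w (cls X) = 0 → K.coaisle 1 X := by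
      refine hws.induction fun X hX ih hwX => ?_
      by_cases hX0 : IsZero X
      · exact coaisle_of_isZero hX0 1
      obtain ⟨A, hA, hAS⟩ := hwall X hX hX0 hwX
      have hpS := hws S hS.obj hS.not_isZero
      rw [cls_ext hAS, map_add, hwS, add_zero] at hwX
      exact coaisle_mid hAS (ih A hA (by rw [cls_ext hAS, map_add]; lia) hwX) hSK
    refine le_of_free_le hHJ hJH (hHL.trans hLK) fun X hX => ?_
    obtain ⟨a, b, h, ha, hb⟩ := exists_torsion_free hHL hLH hX.1
    exact ⟨hX.1, coaisle_mid h (hwK a (obj_of_torsion hHL ha)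
      (hwTF a ha (free_sub hHJ h ha.1 hb.1 hX.2))) (coaisle_of_le hLK hb.2)⟩
  · obtain ⟨N₁, hN₁⟩ := hI.nonempty
    obtain ⟨N₂, hN₂, hN⟩ := hI.exists_gt N₁
    refine ⟨(N₁ • w - s) + (N₂ • w - s), fun X hX hX0 => ?_⟩
    have h1 := realFunctional_mem_heartCone.1 (hIJ N₁ hN₁) X hX
    have h2 := realFunctional_mem_heartCone.1 (hIJ N₂ hN₂) X hX
    rw [AddMonoidHom.add_apply]
    by_contra! hc
    -- Otherwise both `w` and `s` vanish on `X`.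
    have h3 : (N₁ • w - s) (cls X) = 0 := by lia
    have h4 : (N₂ • w - s) (cls X) = 0 := by lia
    rw [happ] at h3 h4
    have hwX : w (cls X) = 0 := by
      have h5 : ((N₂ : ℤ) - N₁) * w (cls X) = 0 := by rw [sub_mul]; lia
      exact (mul_eq_zero.1 h5).resolve_left (by lia)
    rw [hwX, mul_zero, zero_sub, neg_eq_zero] at h3
    obtain ⟨g, t, h, hg, ht⟩ := exists_ext_of_obj hLJ hJL hX
    have hgH : H.obj g := ⟨aisle_of_le hHL hg.1.1, coaisle_of_le_shift hJH (by lia) hg.2⟩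
    have hwg : w (cls g) = 0 := hwTF g ⟨hgH, hg.1.1⟩ ⟨hgH, hg.2⟩
    have ht0 : IsZero t := by
      by_contra ht0
      rw [cls_ext h, map_add, cls_shift_one, map_neg, hwg, neg_zero, zero_add] at hwX
      obtain ⟨A, hA, hAS⟩ := hwall t ht.1 ht0 hwX
      exact hS.not_isZero (isZero_of_torsion_of_free (torsion_quotient hJL hAS hA hS.obj ht.2)
        ⟨hS.obj, hSJ⟩)
    have hsg : s (cls g) = 0 := by
      rw [cls_ext h, map_add, cls_shift_one, map_neg, cls_isZero ht0, map_zero] at h3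
      lia
    have hg0 : IsZero g := by
      by_contra hg0
      have := hws g hg.1 hg0
      rw [AddMonoidHom.add_apply] at this
      lia
    exact hX0 (h.isZero_mid (Functor.map_isZero _ hg0) ht0)

/-- If there are finitely many cones, one can cross a wall of an algebraic heart `L` towards any
larger heart `K` and reach an algebraic heart again. -/
theorem exists_isPositive_gt [IsTriangulated D]
    (hfin : (heartCone '' Set.Icc H H.shift).Finite) {p : TriangulatedK D →+ ℤ}
    (hp : H.IsPositive p) (hHL : H ≤ L) (hL : L.IsLength) (hLK : L ≤ K) (hKH : K ≤ H.shift)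
    (h : ¬ K ≤ L) : ∃ J : BoundedHeart D, L ≤ J ∧ J ≤ K ∧ ¬ J ≤ L ∧ ∃ m, J.IsPositive m := by
  have hKL : K ≤ L.shift := hKH.trans (shift_le_shift hHL)
  obtain ⟨S, hS, hSK⟩ := exists_simple_of_not_le hLK hKL h hL
  have hSH : H.obj S := ⟨aisle_of_le hHL hS.obj.1, coaisle_of_le_shift hKH (by lia) hSK⟩
  obtain ⟨w, s, hw, hwS, hsS, hws, hwall⟩ := exists_wall_functionals hL hS
  choose J hHJ hJH hJ using fun N : ℕ => exists_realFunctional_mem_heartCone hp (N • w - s)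
  have : Finite (heartCone '' Set.Icc H H.shift) := hfin
  obtain ⟨⟨c, hc⟩, hinf⟩ := Finite.exists_infinite_fiber
    fun N : ℕ => (⟨(J N).heartCone, J N, ⟨hHJ N, hJH N⟩, rfl⟩ : heartCone '' Set.Icc H H.shift)
  have hI : {N : ℕ | (J N).heartCone = c}.Infinite := by
    rw [← Set.infinite_coe_iff]
    refine (Equiv.subtypeEquivRight fun N => ?_).infinite_iff.2 hinf
    exact (Subtype.ext_iff (a1 := ⟨(J N).heartCone, _⟩) (a2 := ⟨c, hc⟩)).symm
  obtain ⟨N₀, hN₀⟩ := hI.nonempty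
  refine ⟨J N₀, isPositive_of_wall_crossing hHL (hLK.trans hKH) (hHJ N₀) (hJH N₀) hLK hS hSH hSK hw
    hwS hsS hws hwall hI fun N hN => ?_⟩
  rw [show (J N₀).heartCone = c from hN₀, ← show (J N).heartCone = c from hN]
  exact hJ N

theorem isPositive_of_le_of_le {m : TriangulatedK D →+ ℤ} (hm : L.IsPositive m) (hLK : L ≤ K)
    (hKL : K ≤ L) : K.IsPositive m :=
  fun X hX => hm X (obj_eq_of_le_of_le hLK hKL ▸ hX)

/-- If there are finitely many heart cones, all intermediate hearts are algebraic: walking from `H`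
towards `K` through algebraic hearts produces pairwise distinct cones, so that the walk ends. -/
theorem isAlgebraic_of_finite_heartCones [IsTriangulated D] (hH : H.IsAlgebraic)
    (hfin : (heartCone '' Set.Icc H H.shift).Finite) (hHK : H ≤ K) (hKH : K ≤ H.shift) :
    K.IsAlgebraic := by
  have := hH.module_finite
  obtain ⟨p, hp⟩ := hH.isLength.exists_isPositive
  by_contra hK
  let α := {L : BoundedHeart D // H ≤ L ∧ L ≤ K ∧ ∃ m, L.IsPositive m}
  have : Nonempty α := ⟨⟨H, le_rfl, hHK, p, hp⟩⟩
  have : NoMaxOrder α := ⟨fun ⟨L, hHL, hLK, m, hm⟩ => by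
    obtain ⟨J, hLJ, hJK, hJL, hJ⟩ := exists_isPositive_gt hfin hp hHL hm.isLength hLK hKH
      fun hKL => hK (isPositive_of_le_of_le hm hLK hKL).isAlgebraic
    exact ⟨⟨J, hHL.trans hLJ, hJK, hJ⟩, lt_of_le_not_ge hLJ hJL⟩⟩
  obtain ⟨f, hf⟩ := Nat.exists_strictMono α
  have hinj : Function.Injective fun n => (f n).1.heartCone :=
    Function.Injective.of_lt_imp_ne fun i j hij => by
      obtain ⟨m, hm⟩ := (f i).2.2.2
      have h := hf hij
      exact heartCone_ne h.le (((f j).2.2.1.trans hKH).trans (shift_le_shift (f i).2.1))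
        h.not_ge hm
  refine Set.infinite_range_of_injective hinj (hfin.subset ?_)
  rintro _ ⟨n, rfl⟩
  exact ⟨_, ⟨(f n).2.1, (f n).2.2.1.trans hKH⟩, rfl⟩

end BoundedHeart

end Stability

/-! ### Infinitely many intermediate hearts -/

section Infinite

variable {D : Type u} [Category.{v} D] [Preadditive D] [HasZeroObject D] [HasShift D ℤ]
  [∀ n : ℤ, (shiftFunctor D n).Additive] [Pretriangulated D]

namespace BoundedHeart

variable {H L : BoundedHeart D}

/-- If there are infinitely many hearts above the algebraic heart `L`, then one of the finitely many
simple objects of `L` is torsion-free for infinitely many of them, and these lie above the tilt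
at the intersection of their torsion-free classes. -/
theorem exists_gt_infinite [IsTriangulated D] {p : TriangulatedK D →+ ℤ} (hp : H.IsPositive p)
    (hHL : H ≤ L) (hLH : L ≤ H.shift) (hL : L.IsAlgebraic)
    (hinf : (obj '' Set.Icc L H.shift).Infinite) :
    ∃ J : BoundedHeart D, L ≤ J ∧ J ≤ H.shift ∧ ¬ J ≤ L ∧ (obj '' Set.Icc J H.shift).Infinite := by
  obtain ⟨s, hs, hsS, hs'⟩ := hL.exists_finite_simples
  obtain ⟨S, hS, hSinf⟩ :
      ∃ S ∈ s, (obj '' {K | K ∈ Set.Icc L H.shift ∧ K.coaisle 1 S}).Infinite := by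
    by_contra! hc
    refine hinf (((Set.finite_singleton L.obj).union
      (hs.biUnion hc)).subset ?_)
    rintro _ ⟨K, ⟨hLK, hKH⟩, rfl⟩
    by_cases hKL : K ≤ L
    · exact Or.inl (obj_eq_of_le_of_le hLK hKL).symm
    · obtain ⟨R, hR, hRK⟩ :=
        exists_simple_of_not_le hLK (hKH.trans (shift_le_shift hHL)) hKL hL.isLength
      obtain ⟨S, hS, ⟨e⟩⟩ := hs' R hR
      exact Or.inr (Set.mem_biUnion hS ⟨K, ⟨⟨hLK, hKH⟩, coaisle_of_iso e.symm hRK⟩, rfl⟩)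
  obtain ⟨F, hF⟩ : ∃ F : ObjectProperty D, ∀ X, F X ↔
      H.obj X ∧ ∀ K : BoundedHeart D, L ≤ K → K ≤ H.shift → K.coaisle 1 S → K.coaisle 1 X :=
    ⟨fun _ => _, fun _ => Iff.rfl⟩
  have hFc : H.IsTorsionFreeClass F := by
    constructor
    · exact fun h => ((hF _).1 h).1
    · exact fun h => (hF _).2 ⟨obj_of_isZero h, fun K _ _ _ => coaisle_of_isZero h 1⟩
    · exact fun hA hB h hX => (hF _).2 ⟨hA, fun K h1 h2 h3 =>
        (free_sub (hHL.trans h1) h hA hB (((hF _).1 hX).2 K h1 h2 h3)).2⟩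
    · exact fun h hA hB => (hF _).2 ⟨obj_mid h ((hF _).1 hA).1 ((hF _).1 hB).1, fun K h1 h2 h3 =>
        coaisle_mid h (((hF _).1 hA).2 K h1 h2 h3) (((hF _).1 hB).2 K h1 h2 h3)⟩
  have hfree := free_tilt hFc hp
  have hle := le_tilt hFc hp
  have hge := tilt_le_shift hFc hp
  generalize tilt hFc hp = J at hfree hle hge
  refine ⟨J, le_of_free_le hHL hLH hle fun X hX => ?_, hge, fun hJL => ?_, hSinf.mono ?_⟩
  · rw [hfree]
    exact (hF X).2 ⟨hX.1, fun K hLK _ _ => coaisle_of_le hLK hX.2⟩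
  · obtain ⟨_, ⟨K, ⟨⟨hLK, hKH⟩, hSK⟩, -⟩⟩ := hSinf.nonempty
    have hSF : F S := (hF S).2 ⟨⟨aisle_of_le hHL (hsS S hS).obj.1,
      coaisle_of_le_shift hKH (by lia) hSK⟩, fun _ _ _ h => h⟩
    rw [← hfree] at hSF
    exact (hsS S hS).not_isZero
      (isZero_of_aisle_of_coaisle (by lia) (hsS S hS).obj.1 (coaisle_of_le hJL hSF.2))
  · refine Set.image_mono ?_
    rintro K ⟨⟨hLK, hKH⟩, hSK⟩
    refine ⟨le_of_free_le hle hge (hHL.trans hLK) ?_, hKH⟩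
    rw [hfree]
    exact fun X hX => ⟨((hF X).1 hX).1, ((hF X).1 hX).2 K hLK hKH hSK⟩

/-- The supremum of a strictly increasing sequence of intermediate hearts is not algebraic: its
finitely many simple objects would all occur at a finite stage. -/
theorem exists_not_isAlgebraic_of_strictMono [IsTriangulated D] {p : TriangulatedK D →+ ℤ}
    (hp : H.IsPositive p) {L : ℕ → BoundedHeart D} (hL : StrictMono L) (hHL : ∀ n, H ≤ L n)
    (hLH : ∀ n, L n ≤ H.shift) :
    ∃ K : BoundedHeart D, H ≤ K ∧ K ≤ H.shift ∧ ¬ K.IsAlgebraic := by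
  obtain ⟨F, hF⟩ : ∃ F : ObjectProperty D, ∀ X, F X ↔ ∃ n, H.free (L n) X :=
    ⟨fun _ => _, fun _ => Iff.rfl⟩
  have hFc : H.IsTorsionFreeClass F := by
    constructor
    · exact fun h => ((hF _).1 h).elim fun _ h => h.1
    · exact fun h => (hF _).2 ⟨0, obj_of_isZero h, coaisle_of_isZero h 1⟩
    · intro A X B hA hB h hX
      obtain ⟨n, hn⟩ := (hF _).1 hX
      exact (hF _).2 ⟨n, free_sub (hHL n) h hA hB hn.2⟩
    · intro A X B h hA hB
      obtain ⟨m, hm⟩ := (hF _).1 hA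
      obtain ⟨n, hn⟩ := (hF _).1 hB
      exact (hF _).2 ⟨max m n, free_mid h
        (free_le_of_le (hL.monotone (le_max_left m n)) _ hm)
        (free_le_of_le (hL.monotone (le_max_right m n)) _ hn)⟩
  have hfree := free_tilt hFc hp
  have hle := le_tilt hFc hp
  have hge := tilt_le_shift hFc hp
  generalize tilt hFc hp = K at hfree hle hge
  refine ⟨K, hle, hge, fun hK => ?_⟩
  have hLK : ∀ n, L n ≤ K := fun n => le_of_free_le (hHL n) (hLH n) hle fun X hX => by
    rw [hfree]
    exact (hF X).2 ⟨n, hX⟩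
  obtain ⟨s, hs, hsS, hs'⟩ := hK.exists_finite_simples
  have hstage : ∀ S ∈ s, ∃ n, ∀ m, n ≤ m → (L m).obj S := by
    intro S hS
    obtain ⟨f, t, h, hf, ht⟩ := exists_ext_of_obj hle hge (hsS S hS).obj
    rcases (hsS S hS).isZero_or (obj_shift_of_free hge hf) (obj_of_torsion hle ht) h with h0 | h0
    · obtain ⟨e⟩ := h.iso_of_isZero_left h0
      exact ⟨0, fun m _ => obj_of_iso e.symm
        (obj_of_torsion (hHL m) ⟨ht.1, aisle_of_le (hLK m) ht.2⟩)⟩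
    · obtain ⟨e⟩ := h.iso_of_isZero_right h0
      rw [hfree] at hf
      obtain ⟨n, hn⟩ := (hF f).1 hf
      exact ⟨n, fun m hm => obj_of_iso e
        (obj_shift_of_free (hLH m) (free_le_of_le (hL.monotone hm) _ hn))⟩
  obtain ⟨N, hN⟩ : ∃ N, ∀ S ∈ s, (L N).obj S := by
    choose! n hn using hstage
    obtain ⟨N, hN⟩ := (hs.image n).bddAbove
    exact ⟨N, fun S hS => hn S hS N (hN ⟨S, hS, rfl⟩)⟩
  have hobj : ∀ X, K.Filtered X → (L N).obj X := by
    intro X hX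
    induction hX with
    | zero X h0 => exact obj_of_isZero h0
    | ext A X S h _ hS ih =>
      obtain ⟨S', hS', ⟨e⟩⟩ := hs' S hS
      exact obj_mid h ih (obj_of_iso e (hN S' hS'))
  have hKL : K ≤ L N := le_of_free_le hle hge (hHL N) fun X hX => ⟨hX.1,
    (coaisle_shift_iff 1 1 0 (by lia)).1
      (hobj _ (hK.isLength _ (obj_shift_of_free hge hX))).2⟩
  exact (hL (Nat.lt_succ_self N)).not_ge ((hLK (N + 1)).trans hKL)

/-- If all intermediate hearts are algebraic, there are finitely many: otherwise
`exists_gt_infinite` yields a strictly increasing sequence of hearts, whose supremum is not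
algebraic. -/
theorem finite_of_forall_isAlgebraic [IsTriangulated D]
    (h : ∀ K : BoundedHeart D, H ≤ K → K ≤ H.shift → K.IsAlgebraic) :
    (obj '' Set.Icc H H.shift).Finite := by
  obtain ⟨p, hp⟩ := (h H le_rfl le_shift_self).isLength.exists_isPositive
  by_contra hinf
  let α := {L : BoundedHeart D // H ≤ L ∧ L ≤ H.shift ∧ (obj '' Set.Icc L H.shift).Infinite}
  have : Nonempty α := ⟨⟨H, le_rfl, le_shift_self, hinf⟩⟩
  have : NoMaxOrder α := ⟨fun ⟨L, hHL, hLH, hLinf⟩ => by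
    obtain ⟨J, hLJ, hJH, hJL, hJ⟩ := exists_gt_infinite hp hHL hLH (h L hHL hLH) hLinf
    exact ⟨⟨J, hHL.trans hLJ, hJH, hJ⟩, lt_of_le_not_ge hLJ hJL⟩⟩
  obtain ⟨f, hf⟩ := Nat.exists_strictMono α
  obtain ⟨K, hHK, hKH, hK⟩ := exists_not_isAlgebraic_of_strictMono hp (L := fun n => (f n).1)
    (fun _ _ hij => hf hij) (fun n => (f n).2.1) fun n => (f n).2.2.1
  exact hK (h K hHK hKH)

end BoundedHeart

end Infinite

/-! ### Faces of the cone of an algebraic heart -/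

section Faces

variable {D : Type u} [Category.{v} D] [Preadditive D] [HasZeroObject D] [HasShift D ℤ]
  [∀ n : ℤ, (shiftFunctor D n).Additive] [Pretriangulated D]

namespace BoundedHeart

open TriangulatedK (cls)

variable {K : BoundedHeart D}

theorem mem_heartCone_of_simples (hK : K.IsLength) {s : Set D}
    (hs : ∀ S, K.IsSimpleObj S → ∃ S' ∈ s, Nonempty (S' ≅ S)) {v : TriangulatedK D →+ ℝ}
    (hv : ∀ S ∈ s, 0 ≤ v (cls S)) : v ∈ K.heartCone := by
  intro X hX
  induction hK X hX with
  | zero X h0 => rw [TriangulatedK.cls_isZero h0, map_zero]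
  | ext A X S h hA hS ih =>
    obtain ⟨S', hS', ⟨e⟩⟩ := hs S hS
    rw [TriangulatedK.cls_ext h, map_add, ← TriangulatedK.cls_iso e]
    exact add_nonneg (ih hA.obj) (hv S' hS')

/-- A face of the cone of an algebraic heart is determined by the set of those simple objects at
which all its functionals vanish, so that there are finitely many faces. -/
theorem IsAlgebraic.finite_faces [IsTriangulated D] (hK : K.IsAlgebraic) :
    {τ : PointedCone ℝ (TriangulatedK D →+ ℝ) | τ.IsFaceOf K.heartCone}.Finite := by
  obtain ⟨s, hs, hsS, hs'⟩ := hK.exists_finite_simples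
  let J (τ : PointedCone ℝ (TriangulatedK D →+ ℝ)) : Set D := {S ∈ s | ∀ u ∈ τ, u (cls S) = 0}
  have key : ∀ σ τ : PointedCone ℝ (TriangulatedK D →+ ℝ), σ.IsFaceOf K.heartCone →
      τ.IsFaceOf K.heartCone → J σ = J τ → σ ≤ τ := by
    intro σ τ hσ hτ hJ v hv
    have hpos : ∀ u ∈ τ, ∀ S ∈ s, 0 ≤ u (cls S) := fun u hu S hS => hτ.le hu S (hsS S hS).obj
    -- Each value of `v` is dominated by that of an element of `τ`: either all of `τ` vanishes at
    -- `S`, and hence `v` too, or a multiple of an element that is positive at `S` will do.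
    have hdom : ∀ S ∈ s, ∃ u ∈ τ, v (cls S) ≤ u (cls S) := by
      intro S hS
      by_cases hSJ : ∀ u ∈ τ, u (cls S) = 0
      · have hSσ : S ∈ J σ := hJ ▸ ⟨hS, hSJ⟩
        exact ⟨0, τ.zero_mem, (hSσ.2 v hv).le⟩
      · push Not at hSJ
        obtain ⟨u, hu, hu0⟩ := hSJ
        obtain ⟨n, hn⟩ := Archimedean.arch (v (cls S)) ((hpos u hu S hS).lt_of_ne' hu0)
        exact ⟨n • u, τ.smul_of_tower_mem n hu, hn⟩
    choose! u hu huv using hdom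
    -- `v` is a summand in the cone of the element `∑ u S` of `τ`.
    have hmem : ∑ S ∈ hs.toFinset, u S ∈ τ := sum_mem fun S hS => hu S (hs.mem_toFinset.1 hS)
    have hsub : (∑ S ∈ hs.toFinset, u S) - v ∈ K.heartCone := by
      refine mem_heartCone_of_simples hK.isLength hs' fun S hS => ?_
      rw [AddMonoidHom.sub_apply, AddMonoidHom.finsetSum_apply, sub_nonneg]
      exact (huv S hS).trans (Finset.single_le_sum (f := fun T => u T (cls S))
        (fun T hT => hpos _ (hu T (hs.mem_toFinset.1 hT)) S hS) (hs.mem_toFinset.2 hS))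
    exact hτ.mem_of_add_mem_right hsub (hσ.le hv) (by rwa [sub_add_cancel])
  refine Set.Finite.of_finite_image (f := J) (hs.finite_subsets.subset ?_) ?_
  · rintro _ ⟨τ, -, rfl⟩
    exact fun _ h => h.1
  · exact fun σ hσ τ hτ h => le_antisymm (key σ τ hσ hτ h) (key τ σ hτ hσ h.symm)

end BoundedHeart

end Faces

/-! ### The equivalence -/

theorem BoundedHeart.heartCone_eq_of_obj_eq {D : Type u} [Category.{v} D] [Preadditive D]
    [HasZeroObject D] [HasShift D ℤ] [∀ n : ℤ, (shiftFunctor D n).Additive] [Pretriangulated D]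
    {K L : BoundedHeart D} (h : K.obj = L.obj) : K.heartCone = L.heartCone := by
  ext v
  change (∀ X, K.obj X → _) ↔ ∀ X, L.obj X → _
  rw [h]

theorem theorem5 {D : Type u} [Category.{v} D] [Preadditive D] [HasZeroObject D] [HasShift D ℤ]
    [∀ n : ℤ, (shiftFunctor D n).Additive] [Pretriangulated D] [IsTriangulated D]
    (H : BoundedHeart D) (hH : H.IsAlgebraic) :
    List.TFAE [
      H.heartFan.Finite,
      ∀ K : BoundedHeart D, K ≤ H.shift → H ≤ K → K.IsAlgebraic,
      {S : ObjectProperty D | ∃ K : BoundedHeart D, K ≤ H.shift ∧ H ≤ K ∧ K.obj = S}.Finite] := by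
  have himage : {S : ObjectProperty D | ∃ K : BoundedHeart D, K ≤ H.shift ∧ H ≤ K ∧ K.obj = S} =
      BoundedHeart.obj '' Set.Icc H H.shift := by
    ext S
    exact ⟨fun ⟨K, h1, h2, h3⟩ => ⟨K, ⟨h2, h1⟩, h3⟩, fun ⟨K, ⟨h2, h1⟩, h3⟩ => ⟨K, h1, h2, h3⟩⟩
  rw [himage]
  have hcones : (BoundedHeart.obj '' Set.Icc H H.shift).Finite →
      (BoundedHeart.heartCone '' Set.Icc H H.shift).Finite := by
    intro h
    obtain ⟨g, hg⟩ : ∃ g : ObjectProperty D → PointedCone ℝ (TriangulatedK D →+ ℝ),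
        ∀ K : BoundedHeart D, g K.obj = K.heartCone :=
      ⟨Function.extend BoundedHeart.obj BoundedHeart.heartCone fun _ => ⊥, fun K =>
        Function.FactorsThrough.extend_apply
          (fun _ _ h => BoundedHeart.heartCone_eq_of_obj_eq h) _ K⟩
    refine (h.image g).subset ?_
    rintro _ ⟨K, hK, rfl⟩
    exact ⟨K.obj, ⟨K, hK, rfl⟩, hg K⟩
  tfae_have 1 → 2 := fun h K hKH hHK => by
    refine BoundedHeart.isAlgebraic_of_finite_heartCones hH (h.subset ?_) hHK hKH
    rintro _ ⟨L, hL, rfl⟩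
    exact ⟨L, hL, .refl _⟩
  tfae_have 3 → 2 := fun h K hKH hHK =>
    BoundedHeart.isAlgebraic_of_finite_heartCones hH (hcones h) hHK hKH
  tfae_have 2 → 3 := fun h => BoundedHeart.finite_of_forall_isAlgebraic fun K h1 h2 => h K h2 h1
  tfae_have 2 → 1 := fun h => by
    have hfin := hcones (BoundedHeart.finite_of_forall_isAlgebraic fun K h1 h2 => h K h2 h1)
    refine (hfin.biUnion (t := fun σ => {τ | τ.IsFaceOf σ}) ?_).subset ?_
    · rintro _ ⟨K, ⟨hHK, hKH⟩, rfl⟩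
      exact (h K hKH hHK).finite_faces
    · rintro τ ⟨K, hK, hτ⟩
      exact Set.mem_biUnion ⟨K, hK, rfl⟩ hτ
  tfae_finish
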